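/- Points of $\mathbb{R}^n\times(-\infty,0]$ are written $(x,t)$; $D^2u$ is the Hessian in $x$, $\sigma_k(D^2u)$ is the $k$-th elementary symmetric function of its eigenvalues ($\sigma_k=0$ for $k>n$), and $|D^2u|$ is its Euclidean (Frobenius) norm. For $\Omega\subset\mathbb{R}^n\times(-\infty,0]$ let $\Omega(t)=\{x:(x,t)\in\Omega\}$, and let the parabolic boundary $\partial_p\Omega$ (bottom and lateral boundary) be the set of those $(x,t)\in\overline{\Omega}$ for which no backward cylinder $B_r(x)\times(t-r^2,t)$, $r>0$, is contained in $\Omega$. We write $u\in C^{4,2}(\overline\Omega)$ if $u$ is continuous on $\overline\Omega$ and all derivatives $D_x^aD_t^bu$ with $|a|+2b\le 4$ exist in $\Omega$ (one-sided in $t$ at $t=0$) and extend continuously to $\overline\Omega$. The function $u$ is $2$-convex-monotone in $\Omega$ if $\sigma_1(D^2u)>0$ and $\sigma_2(D^2u)>0$ in $\Omega$ and $u$ is non-increasing in $t$ (along the vertical segments contained in $\Omega$). **Lemma (Pogorelov-type interior estimate).** Let $n\in\mathbb{N}$, $A\ge 0$, $m_1\ge m_2>0$ and $d,M\in\mathbb{R}$.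 There is $\alpha_0>0$, depending only on $n,A,m_1,m_2,d,M$, such that for every $\alpha\ge\alpha_0$ there is a constant $C$, depending only on $\alpha$ and on $n,A,m_1,m_2,d,M$, with the following property. Let $\Omega$ be a bounded, relatively open subset of $\mathbb{R}^n\times(-\infty,0]$ (for example a bounded domain) with $\operatorname{diam}\Omega(t)\le d$ for all $t\le 0$, and let $u\in C^{4,2}(\overline\Omega)$ be a $2$-convex-monotone solution of $$-u_t\,\sigma_2(D^2u)=1\ \text{ in }\Omega,\qquad u=0\ \text{ on }\partial_p\Omega,$$ such that $\sigma_3(D^2u)\ge -A$, $-m_1\le u_t\le -m_2$ and $|u|\le M$ in $\Omega$. Then $u\le 0$ in $\Omega$ and $$(-u)^{\alpha}\,|D^2u|\le C\quad\text{in }\Omega .$$ -/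

import Mathlib

open Set

noncomputable section

namespace ParabolicHessian

/-- Space-time `ℝⁿ × ℝ`, a point being `(x, t)`. -/
abbrev SpaceTime (n : ℕ) : Type := EuclideanSpace ℝ (Fin n) × ℝ

/-- `Ω` is a relatively open subset of `ℝⁿ × (-∞, 0]`. -/
def IsRelOpen {n : ℕ} (Ω : Set (SpaceTime n)) : Prop :=
  ∃ V : Set (SpaceTime n), IsOpen V ∧ Ω = V ∩ {p | p.2 ≤ 0}

/-- The time slice `Ω(t) = {x | (x, t) ∈ Ω}`. -/
def slice {n : ℕ} (Ω : Set (SpaceTime n)) (t : ℝ) : Set (EuclideanSpace ℝ (Fin n)) :=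
  {x | (x, t) ∈ Ω}

/-- The parabolic boundary `∂ₚΩ`: the points `(x, t)` of the closure of `Ω` such that no backward
cylinder `B_r(x) × (t - r², t)` is contained in `Ω`. It consists of the bottom and of the lateral
boundary of `Ω`; the points of `Ω` and of its flat top do not belong to it. -/
def parabolicBoundary {n : ℕ} (Ω : Set (SpaceTime n)) : Set (SpaceTime n) :=
  {p | p ∈ closure Ω ∧
    ∀ r : ℝ, 0 < r → ¬ (Metric.ball p.1 r ×ˢ Ioo (p.2 - r ^ 2) p.2 ⊆ Ω)}

/-- The spatial partial derivative `∂w/∂xᵢ`. -/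
def dx {n : ℕ} (i : Fin n) (w : SpaceTime n → ℝ) (p : SpaceTime n) : ℝ :=
  lineDeriv ℝ (fun y => w (y, p.2)) p.1 (EuclideanSpace.single i 1)

/-- The time derivative `w_t`, taken within `(-∞, 0]` (so it is one-sided at `t = 0`). -/
def dt {n : ℕ} (w : SpaceTime n → ℝ) (p : SpaceTime n) : ℝ :=
  derivWithin (fun s => w (p.1, s)) (Iic 0) p.2

/-- `w` is differentiable in the variable `xᵢ` at all points of `Ω`. -/
def HasDx {n : ℕ} (Ω : Set (SpaceTime n)) (i : Fin n) (w : SpaceTime n → ℝ) : Prop :=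
  ∀ p ∈ Ω, LineDifferentiableAt ℝ (fun y => w (y, p.2)) p.1 (EuclideanSpace.single i 1)

/-- `w` is differentiable in `t` (within `(-∞, 0]`) at all points of `Ω`. -/
def HasDt {n : ℕ} (Ω : Set (SpaceTime n)) (w : SpaceTime n → ℝ) : Prop :=
  ∀ p ∈ Ω, DifferentiableWithinAt ℝ (fun s => w (p.1, s)) (Iic 0) p.2

/-- The restriction of `w` to `Ω` extends continuously to the closure of `Ω`. -/
def ExtendsCont {n : ℕ} (Ω : Set (SpaceTime n)) (w : SpaceTime n → ℝ) : Prop :=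
  ∃ v : SpaceTime n → ℝ, ContinuousOn v (closure Ω) ∧ EqOn v w Ω

/-- All derivatives of `w` of parabolic order at most `k` (a derivative in `x` has order one, a
derivative in `t` has order two) exist in `Ω` and extend continuously to the closure of `Ω`. -/
def ParabolicDiff {n : ℕ} (Ω : Set (SpaceTime n)) : ℕ → (SpaceTime n → ℝ) → Prop
  | 0, w => ExtendsCont Ω w
  | 1, w => ExtendsCont Ω w ∧ ∀ i, HasDx Ω i w ∧ ExtendsCont Ω (dx i w)
  | k + 2, w => ExtendsCont Ω w ∧
      (∀ i, HasDx Ω i w ∧ ParabolicDiff Ω (k + 1) (dx i w)) ∧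
      (HasDt Ω w ∧ ParabolicDiff Ω k (dt w))

/-- `u ∈ C^{4,2}(Ω̄)`: `u` is continuous on the closure of `Ω`, and the derivatives
`D_x^a D_t^b u` with `|a| + 2 b ≤ 4` exist in `Ω` and extend continuously to the closure. -/
def IsC42 {n : ℕ} (Ω : Set (SpaceTime n)) (u : SpaceTime n → ℝ) : Prop :=
  ContinuousOn u (closure Ω) ∧ ParabolicDiff Ω 4 u

/-- The spatial Hessian `D²u`. -/
def hess {n : ℕ} (u : SpaceTime n → ℝ) (p : SpaceTime n) : Matrix (Fin n) (Fin n) ℝ :=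
  Matrix.of fun i j => dx i (dx j u) p

/-- `σ_k(W) = σ_k(λ[W])`, the `k`-th elementary symmetric function of the eigenvalues of a
symmetric matrix `W`, listed with multiplicity as the roots of its characteristic polynomial. -/
def sigma {n : ℕ} (k : ℕ) (W : Matrix (Fin n) (Fin n) ℝ) : ℝ :=
  W.charpoly.roots.esymm k

/-- The Euclidean (Frobenius) norm `|W|` of a matrix. -/
def matNorm {n : ℕ} (W : Matrix (Fin n) (Fin n) ℝ) : ℝ :=
  Real.sqrt (∑ i, ∑ j, W i j ^ 2)

/-- `u` is `k`-convex-monotone in `Ω`: the eigenvalues of `D²u` lie in the Gårding cone `Γ_k`, and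
`u` is non-increasing in `t` along the vertical segments contained in `Ω`. -/
def IsConvexMonotone {n : ℕ} (k : ℕ) (Ω : Set (SpaceTime n)) (u : SpaceTime n → ℝ) : Prop :=
  (∀ p ∈ Ω, ∀ j : ℕ, 1 ≤ j → j ≤ k → 0 < sigma j (hess u p)) ∧
  (∀ (x : EuclideanSpace ℝ (Fin n)) (s t : ℝ), s ≤ t → (∀ r ∈ Icc s t, (x, r) ∈ Ω) →
    u (x, t) ≤ u (x, s))

end ParabolicHessian

end

/-! Since `u_t < 0`, `u` decreases strictly up every vertical segment, so its maximum over the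
closure lies on the parabolic boundary and `u < 0` in `Ω`. Moreover `|D²u|² = (Δu)² - 2σ₂`, so it
suffices to bound `(-u)^α Δu` at a given point `(x₀, T)`. The test function is `Φ = (-u)^α Δu
exp(3/2 |x - x₀|²)`.

The engine is a Jacobi inequality for `log Δu`. Let `q = σ₂`, which the equation confines to `[1/m₁,
1/m₂]`, and let `F = (Δu) I - D²u` be the linearization of `σ₂`. Differentiating the equation twice
and tracing (`linearized_lap`) gives `F : D²Δu = q² (Δu)_t + (2/q)|Dσ₂|² + |D³u|² - |DΔu|²`. If `Δu`
is large, `σ₃ ≥ -A` forces one eigenvalue to be close to the trace and the others to be small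
(`exists_large_eigenvalue`). The last three terms then dominate `5/4 F(DΔu, DΔu)/Δu`
(`jacobi_inequality`), which exceeds by a quarter what the Hessian of the logarithm costs. At a
maximum of `log Φ` this quarter, through the first-order condition, absorbs `α F(Du, Du)/u²`; the
quadratic weight leaves a full `tr F ≥ Δu`, and `-u Δu` is bounded (`diag_max_point_bound`). Where
`Δu` is below the threshold there is nothing to prove.

Two points need care. Only the slices of `Ω` have controlled diameter, so the weight is not
controlled on all of `Ω`. The maximum is therefore taken over `verticalHull`, a compact set whose
points can be moved vertically to time `T`, hence lie within `d` of `x₀` where `u < 0`. This set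
contains backward cylinders at such points, so it creates no new boundary. Also, the maximum may sit
at `t = 0` or outside `Ω`, where the derivatives are not available. `exists_perturbed_max` moves it
into the interior, at the price of a factor `e`, of one unit of the Hessian of the weight (3 becomes
2), and of a time derivative bounded below by `-1` instead of `0`. -/

namespace ParabolicHessian

noncomputable section

open Set Filter Topology

/-! ### Algebra of the Jacobi inequality and of the maximum point, in an eigenbasis. -/

/-- The bound of the terms of the direction of the large eigenvalue `l`. -/
lemma large_direction_nonneg {q l F R N P f s D : ℝ} (hq : 0 < q) (hl : 0 < l) (hF : 0 ≤ F)
    (hR : 0 ≤ R) (hN : 0 ≤ N) (hFl : 2 * F * l + F ^ 2 = R + 2 * q) (hF2 : F ^ 2 ≤ 2 * q / 3)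
    (hP : P ^ 2 ≤ R * N) (hs : l * s = f - F * D + P) :
    5 / 4 * (F / (l + F)) * D ^ 2 ≤ 3 * N + (D - s) ^ 2 - D ^ 2 + 2 * f ^ 2 / q := by
  -- With `D = l X`, the cross term `-2 D s` equals `-2X(f - F D + P)`. It contains the good term `2
  -- F l X²`, of which `5/4` is needed and `3/4` is left for the errors.
  obtain ⟨X, rfl⟩ : ∃ X, D = l * X := ⟨D / l, by field_simp⟩
  have h1 : F / (l + F) * (l * X) ^ 2 ≤ F * l * X ^ 2 := by
    rw [div_mul_eq_mul_div, div_le_iff₀ (by positivity)]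
    have : 0 ≤ F ^ 2 * l * X ^ 2 := by positivity
    nlinarith
  have h2 : 2 * X * f ≤ 2 * f ^ 2 / q + q * X ^ 2 / 2 := by
    have : 2 * f ^ 2 / q + q * X ^ 2 / 2 - 2 * X * f = 2 / q * (f - q * X / 2) ^ 2 := by
      field_simp; ring
    have : 0 ≤ 2 / q * (f - q * X / 2) ^ 2 := by positivity
    linarith
  have h3 : 2 * X * P ≤ 3 * N + R * X ^ 2 / 3 := by
    have hsq : (2 * X * P) ^ 2 ≤ (3 * N + R * X ^ 2 / 3) ^ 2 := by
      have := mul_le_mul_of_nonneg_left hP (sq_nonneg X)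
      nlinarith [sq_nonneg (3 * N - R * X ^ 2 / 3)]
    exact (abs_le_of_sq_le_sq' hsq (by positivity)).2
  have h4 : (l * X - s) ^ 2 - (l * X) ^ 2 = s ^ 2 - 2 * X * (f - F * (l * X) + P) := by
    rw [← hs]; ring
  -- `F² ≤ 2q/3` gives `2Fl ≥ R + 4q/3`, hence `3/4 Fl ≥ 3R/8 + q/2`: the coefficient of `q` is used
  -- up exactly.
  have h5 : 0 ≤ X ^ 2 * (3 / 4 * (F * l) - q / 2 - R / 3) := by
    apply mul_nonneg (sq_nonneg _)
    nlinarith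
  nlinarith [sq_nonneg s]

/-- The bound of the terms of a direction of a small eigenvalue. -/
lemma small_direction_nonneg {q l F G R N P f v D : ℝ} (hq : 0 < q) (hl : 0 < l) (hF : 0 ≤ F)
    (hN : 0 ≤ N) (hP : P ^ 2 ≤ R * N) (hG : G ≤ 6 / 5 * (l + F))
    (hD : (l + F) * D = l * v + f + P) (hR : 55 * R ≤ (l + F) ^ 2)
    (hq' : 55 * q ≤ 2 * (l + F) ^ 2) :
    5 / 4 * (G / (l + F)) * D ^ 2 ≤ 3 * v ^ 2 + N - D ^ 2 + 2 * f ^ 2 / q := by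
  have hE : 0 < l + F := by positivity
  have h1 : G / (l + F) ≤ 6 / 5 := by rw [div_le_iff₀ hE]; exact hG
  have h2 : G / (l + F) * D ^ 2 ≤ 6 / 5 * D ^ 2 := by gcongr
  -- `5/2 = 1 + 5/4 · 6/5`. Up to errors divided by `l + F`, `D` is at most `v`; Young's inequality
  -- with factors `11/10` and `22` leaves `11/4 ≤ 3` on `v²`, and `22 · 5/2 = 55` explains the
  -- constant in the hypotheses.
  have h3 : 5 / 2 * D ^ 2 ≤ 3 * v ^ 2 + N + 2 * f ^ 2 / q := by
    have h4 : 55 * f ^ 2 ≤ (l + F) ^ 2 * (2 * f ^ 2 / q) := by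
      rw [mul_div_assoc', le_div_iff₀ hq]
      nlinarith [sq_nonneg f, mul_le_mul_of_nonneg_right hq' (sq_nonneg f)]
    have h5 : 55 * (R * N) ≤ (l + F) ^ 2 * N := by nlinarith
    have h6 : l ^ 2 * v ^ 2 ≤ (l + F) ^ 2 * v ^ 2 := by
      gcongr; linarith
    have h7 : (l + F) ^ 2 * D ^ 2 ≤ 11 / 10 * (l ^ 2 * v ^ 2) + 22 * (f ^ 2 + P ^ 2) := by
      rw [← mul_pow, hD]
      nlinarith [sq_nonneg (l * v - 10 * (f + P)), sq_nonneg (f - P)]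
    have h8 : (l + F) ^ 2 * (5 / 2 * D ^ 2) ≤ (l + F) ^ 2 * (3 * v ^ 2 + N + 2 * f ^ 2 / q) := by
      nlinarith [sq_nonneg ((l + F) * v)]
    exact le_of_mul_le_mul_left h8 (by positivity)
  nlinarith

section Jacobi

variable {ι : Type*} [Fintype ι] [DecidableEq ι]

/-- Of the squares of the entries of a symmetric `3`-tensor, those with two equal indices. -/
lemma sum_sq_diag_le_sum_sq {T : ι → ι → ι → ℝ} (hT₁ : ∀ a b c, T a b c = T b a c)
    (hT₂ : ∀ a b c, T a b c = T a c b) :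
    ∑ k, (3 * ∑ a, T a a k ^ 2 - 2 * T k k k ^ 2) ≤ ∑ a, ∑ b, ∑ c, T a b c ^ 2 := by
  -- Inclusion-exclusion: off the full diagonal at most one of the three coincidences holds; on it
  -- all three do, and two copies are removed.
  have key : ∀ a b c : ι, (if a = b then T a b c ^ 2 else 0) + (if b = c then T a b c ^ 2 else 0)
      + (if a = c then T a b c ^ 2 else 0)
      - 2 * (if a = b then (if b = c then T a b c ^ 2 else 0) else 0) ≤ T a b c ^ 2 := by
    intro a b c
    have := sq_nonneg (T a b c)
    split_ifs <;> first | linarith | (exfalso; grind)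
  have hsum := Finset.sum_le_sum fun a (_ : a ∈ Finset.univ) =>
    Finset.sum_le_sum fun b (_ : b ∈ Finset.univ) =>
      Finset.sum_le_sum fun c (_ : c ∈ Finset.univ) => key a b c
  refine le_trans (le_of_eq ?_) hsum
  simp only [Finset.sum_add_distrib, Finset.sum_sub_distrib, ← Finset.mul_sum]
  have e1 : ∑ a, ∑ b, ∑ c, (if a = b then T a b c ^ 2 else 0) = ∑ k, ∑ a, T a a k ^ 2 := by
    rw [Finset.sum_comm (f := fun k a => T a a k ^ 2)]
    refine Finset.sum_congr rfl fun a _ => ?_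
    rw [Finset.sum_comm]
    exact Finset.sum_congr rfl fun c _ => by rw [Finset.sum_ite_eq, if_pos (Finset.mem_univ _)]
  have e2 : ∑ a, ∑ b, ∑ c, (if b = c then T a b c ^ 2 else 0) = ∑ k, ∑ a, T a a k ^ 2 := by
    refine Finset.sum_congr rfl fun a _ => Finset.sum_congr rfl fun b _ => ?_
    rw [Finset.sum_ite_eq, if_pos (Finset.mem_univ _), hT₁ a b b, hT₂ b a b]
  have e3 : ∑ a, ∑ b, ∑ c, (if a = c then T a b c ^ 2 else 0) = ∑ k, ∑ a, T a a k ^ 2 := by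
    rw [Finset.sum_comm]
    refine Finset.sum_congr rfl fun a _ => Finset.sum_congr rfl fun b _ => ?_
    rw [Finset.sum_ite_eq, if_pos (Finset.mem_univ _), hT₂ b a b]
  have e4 : ∑ a, ∑ b, ∑ c, (if a = b then (if b = c then T a b c ^ 2 else 0) else 0)
      = ∑ k, T k k k ^ 2 := by
    refine Finset.sum_congr rfl fun a _ => ?_
    simp
  rw [e1, e2, e3, e4]
  ring

/-- The threshold for the trace above which the Jacobi inequality holds. -/
def jacobiThreshold (A q₀ q₁ : ℝ) : ℝ :=
  1 + 110 * (4 * q₁ + 12 * A) + 2 * (4 * q₁ + 12 * A) ^ 2 / q₀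

/-- If `σ₂` is bounded, `σ₃` is bounded below and the trace `D` is large, then a single eigenvalue
is large, and it is close to the trace. -/
lemma exists_large_eigenvalue {l : ι → ℝ} {A q q₀ q₁ D : ℝ} (hA : 0 ≤ A) (hq₀ : 0 < q₀)
    (h0 : q₀ ≤ q) (h1 : q ≤ q₁) (hq : D ^ 2 = ∑ a, l a ^ 2 + 2 * q)
    (h3 : ∑ a, l a ^ 2 * (D - l a) ≤ D * q + 3 * A) (hK : jacobiThreshold A q₀ q₁ ≤ D) :
    ∃ m, 0 < l m ∧ 0 ≤ D - l m ∧ (D - l m) ^ 2 ≤ 2 * q / 3 ∧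
      2 * (D - l m) * l m + (D - l m) ^ 2 = ∑ a ∈ Finset.univ.erase m, l a ^ 2 + 2 * q ∧
      55 * ∑ a ∈ Finset.univ.erase m, l a ^ 2 ≤ D ^ 2 ∧ 55 * q ≤ 2 * D ^ 2 := by
  unfold jacobiThreshold at hK
  have hq1 : 0 < q₁ := by linarith
  have hc : 0 ≤ 2 * (4 * q₁ + 12 * A) ^ 2 / q₀ := by positivity
  have hD1 : 1 ≤ D := by linarith
  have hD0 : 0 < D := by linarith
  have hle : ∀ a, l a ^ 2 ≤ D ^ 2 := by
    intro a
    have := Finset.single_le_sum (f := fun a => l a ^ 2) (fun i _ => sq_nonneg (l i))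
      (Finset.mem_univ a)
    linarith
  have hF : ∀ a, 0 ≤ D - l a := fun a => by
    have := (abs_le_of_sq_le_sq' (hle a) hD0.le).2
    linarith
  -- Put `c = 4q₁ + 12A`; the gap `D - l m` will be at most `c/D`. This part of the threshold gives
  -- `55R ≤ D²`, because `R ≤ 2D(D - l m) ≤ 2c`; the part `2c²/q₀` gives `(D - l m)² ≤ 2q/3`.
  have hDc : 110 * (4 * q₁ + 12 * A) ≤ D := by linarith
  have hDc2 : 2 * (4 * q₁ + 12 * A) ^ 2 / q₀ ≤ D := by linarith
  have hDD : D ≤ D ^ 2 := by nlinarith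
  -- Otherwise the sum in `h3` is at least `(D/2)(D² - 2q)`, which is cubic in `D`, while its upper
  -- bound is linear.
  obtain ⟨m, hm⟩ : ∃ m, D / 2 < l m := by
    by_contra! hcon
    have : ∑ a, l a ^ 2 * (D / 2) ≤ ∑ a, l a ^ 2 * (D - l a) :=
      Finset.sum_le_sum fun a _ => mul_le_mul_of_nonneg_left (by linarith [hcon a]) (sq_nonneg _)
    rw [← Finset.sum_mul] at this
    have h5 : D ^ 2 * D ≤ 4 * q * D + 6 * A := by nlinarith
    have h6 : (4 * q + 6 * A) * D < D * D * D := by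
      apply mul_lt_mul_of_pos_right _ hD0
      nlinarith
    nlinarith
  have hlm : l m ^ 2 * (D - l m) ≤ D * q + 3 * A :=
    (Finset.single_le_sum (f := fun a => l a ^ 2 * (D - l a))
      (fun i _ => mul_nonneg (sq_nonneg (l i)) (hF i)) (Finset.mem_univ m)).trans h3
  have hFm : D * (D - l m) ≤ 4 * q₁ + 12 * A := by
    have h7 : D ^ 2 / 4 * (D - l m) ≤ l m ^ 2 * (D - l m) :=
      mul_le_mul_of_nonneg_right (by nlinarith) (hF m)
    have h8 : D * (D * (D - l m)) ≤ D * (4 * q₁ + 12 * A) := by nlinarith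
    exact le_of_mul_le_mul_left h8 hD0
  have hR : ∑ a, l a ^ 2 = l m ^ 2 + ∑ a ∈ Finset.univ.erase m, l a ^ 2 :=
    (Finset.add_sum_erase _ _ (Finset.mem_univ m)).symm
  refine ⟨m, by linarith, hF m, ?_, by rw [hR] at hq; linarith, ?_, by nlinarith⟩
  · have h9 : D ^ 2 * (D - l m) ^ 2 ≤ (4 * q₁ + 12 * A) ^ 2 := by
      rw [← mul_pow]
      exact pow_le_pow_left₀ (mul_nonneg hD0.le (hF m)) hFm 2
    rw [div_le_iff₀ hq₀] at hDc2
    have h10 : D * q₀ ≤ D ^ 2 * q := by nlinarith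
    have h11 : D ^ 2 * (D - l m) ^ 2 ≤ D ^ 2 * (2 * q / 3) := by nlinarith
    exact le_of_mul_le_mul_left h11 (by positivity)
  · rw [hR] at hq
    nlinarith [hF m]

/-- The Jacobi inequality for the logarithm of the trace, in coordinates that diagonalize the
Hessian: `l` are its eigenvalues, `T` is the tensor of the third derivatives. -/
lemma jacobi_inequality {l : ι → ℝ} {T : ι → ι → ι → ℝ} {A q q₀ q₁ D : ℝ}
    (hA : 0 ≤ A) (hq₀ : 0 < q₀) (h0 : q₀ ≤ q) (h1 : q ≤ q₁) (hq : D ^ 2 = ∑ a, l a ^ 2 + 2 * q)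
    (h3 : ∑ a, l a ^ 2 * (D - l a) ≤ D * q + 3 * A) (hK : jacobiThreshold A q₀ q₁ ≤ D)
    (hT₁ : ∀ a b c, T a b c = T b a c) (hT₂ : ∀ a b c, T a b c = T a c b) :
    5 / 4 * ∑ k, (D - l k) / D * (∑ a, T a a k) ^ 2 ≤
      ∑ a, ∑ b, ∑ c, T a b c ^ 2 - ∑ k, (∑ a, T a a k) ^ 2
        + 2 / q * ∑ k, (∑ a, (D - l a) * T a a k) ^ 2 := by
  obtain ⟨m, hm, hF, hF2, hFl, hR, hq'⟩ := exists_large_eigenvalue hA hq₀ h0 h1 hq h3 hK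
  have hqp : 0 < q := by linarith
  set R := ∑ a ∈ Finset.univ.erase m, l a ^ 2 with hRdef
  have hR0 : 0 ≤ R := Finset.sum_nonneg fun _ _ => sq_nonneg _
  have hlF : l m + (D - l m) = D := by ring
  -- The inequality decouples in the differentiation index `k`, once `|T|²` is replaced by the
  -- entries with two equal indices.
  have main : ∀ k, 5 / 4 * ((D - l k) / D * (∑ a, T a a k) ^ 2) ≤
      (3 * ∑ a, T a a k ^ 2 - 2 * T k k k ^ 2) - (∑ a, T a a k) ^ 2
        + 2 / q * (∑ a, (D - l a) * T a a k) ^ 2 := by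
    intro k
    set N := ∑ a ∈ Finset.univ.erase m, T a a k ^ 2 with hN
    set P := ∑ a ∈ Finset.univ.erase m, l a * T a a k with hP
    set s := ∑ a ∈ Finset.univ.erase m, T a a k with hs
    set f := ∑ a, (D - l a) * T a a k with hf
    have hN0 : 0 ≤ N := Finset.sum_nonneg fun _ _ => sq_nonneg _
    have hPs : P ^ 2 ≤ R * N := Finset.sum_mul_sq_le_sq_mul_sq _ _ _
    have eD : ∑ a, T a a k = T m m k + s :=
      (Finset.add_sum_erase _ (fun a => T a a k) (Finset.mem_univ m)).symm
    have eN : ∑ a, T a a k ^ 2 = T m m k ^ 2 + N :=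
      (Finset.add_sum_erase _ (fun a => T a a k ^ 2) (Finset.mem_univ m)).symm
    have ef : f = (D - l m) * T m m k + (D * s - P) := by
      rw [hf, ← Finset.add_sum_erase _ _ (Finset.mem_univ m), hs, hP, Finset.mul_sum,
        ← Finset.sum_sub_distrib]
      congr 1
      exact Finset.sum_congr rfl fun a _ => by ring
    by_cases hk : k = m
    · subst hk
      have := large_direction_nonneg (s := s) (f := f) (D := T k k k + s) hqp hm hF hR0 hN0 hFl hF2
        hPs (by rw [ef]; ring)
      rw [hlF] at this
      rw [eD, eN]
      calc _ = _ := by ring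
        _ ≤ _ := this
        _ = _ := by ring
    · have hkm : k ∈ Finset.univ.erase m := Finset.mem_erase.2 ⟨hk, Finset.mem_univ k⟩
      have hlk : l k ^ 2 ≤ R :=
        Finset.single_le_sum (f := fun a => l a ^ 2) (fun i _ => sq_nonneg (l i)) hkm
      -- The entry `T k k k` counts among the small directions, so `3N - 2 (T k k k)² ≥ N`.
      have hTk : T k k k ^ 2 ≤ N :=
        Finset.single_le_sum (f := fun a => T a a k ^ 2) (fun i _ => sq_nonneg (T i i k)) hkm
      have hDpos : 0 < D := by linarith
      have hlk' : -(D / 5) ≤ l k := by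
        refine (abs_le_of_sq_le_sq' ?_ (by positivity)).1
        nlinarith
      have := small_direction_nonneg (G := D - l k) (f := f) (v := T m m k) (D := T m m k + s)
        hqp hm hF hN0 hPs (by linarith) (by rw [ef]; ring) (by rw [hlF]; exact hR)
        (by rw [hlF]; exact hq')
      rw [hlF] at this
      rw [eD, eN]
      have e : 2 * f ^ 2 / q = 2 / q * f ^ 2 := by ring
      linarith
  have hsum := Finset.sum_le_sum fun k (_ : k ∈ Finset.univ) => main k
  simp only [Finset.sum_add_distrib, Finset.sum_sub_distrib (f := fun k =>
    (3 * ∑ a, T a a k ^ 2 - 2 * T k k k ^ 2)), ← Finset.mul_sum] at hsum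
  have := sum_sq_diag_le_sum_sq hT₁ hT₂
  linarith

/-- The inequality at a maximum point of the test function, in coordinates that diagonalize the
Hessian. -/
lemma diag_max_point_bound {l g y : ι → ℝ} {V : ι → ℝ} {T : ι → ι → ι → ℝ}
    {A q q₀ q₁ D u α θ : ℝ}
    (hA : 0 ≤ A) (hq₀ : 0 < q₀) (h0 : q₀ ≤ q) (h1 : q ≤ q₁) (hD : D = ∑ a, l a)
    (hq : D ^ 2 = ∑ a, l a ^ 2 + 2 * q)
    (h3 : ∑ a, l a ^ 2 * (D - l a) ≤ D * q + 3 * A) (hK : jacobiThreshold A q₀ q₁ ≤ D)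
    (hT₁ : ∀ a b c, T a b c = T b a c) (hT₂ : ∀ a b c, T a b c = T a c b)
    (hu : u < 0) (hα : 8 ≤ α) (hy : 2 * ∑ a, y a ^ 2 ≤ α)
    (hV : ∑ a, (D - l a) * V a = q ^ 2 * θ + 2 / q * ∑ k, (∑ a, (D - l a) * T a a k) ^ 2
      + ∑ a, ∑ b, ∑ c, T a b c ^ 2 - ∑ k, (∑ a, T a a k) ^ 2)
    (hgrad : ∀ a, α * (g a / u) + (∑ b, T b b a) / D + y a = 0)
    (hhess : ∀ a, α * (l a / u - (g a / u) ^ 2) + V a / D - ((∑ b, T b b a) / D) ^ 2 + 2 ≤ 0)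
    (ht : -1 ≤ α * (-(1 / q) / u) + θ / D) :
    -u * D ≤ 3 * α * q₁ + -u * q₁ ^ 2 := by
  have hjac := jacobi_inequality hA hq₀ h0 h1 hq h3 hK hT₁ hT₂
  have hqp : 0 < q := by linarith
  have hD1 : 1 ≤ D := by
    refine le_trans ?_ hK
    unfold jacobiThreshold
    have : 0 ≤ 110 * (4 * q₁ + 12 * A) := by nlinarith
    have : 0 ≤ 2 * (4 * q₁ + 12 * A) ^ 2 / q₀ := by positivity
    linarith
  have hD0 : 0 < D := by linarith
  have hle : ∀ a, l a ^ 2 ≤ D ^ 2 := by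
    intro a
    have := Finset.single_le_sum (f := fun a => l a ^ 2) (fun i _ => sq_nonneg (l i))
      (Finset.mem_univ a)
    linarith
  have hF : ∀ a, 0 ≤ D - l a := fun a => by
    have := (abs_le_of_sq_le_sq' (hle a) hD0.le).2
    linarith
  set Z := ∑ k, (D - l k) / D * (∑ a, T a a k) ^ 2 with hZ
  set trF := ∑ a, (D - l a) with htrF
  have hFtr : ∀ a, D - l a ≤ trF := fun a =>
    Finset.single_le_sum (f := fun a => D - l a) (fun i _ => hF i) (Finset.mem_univ a)
  -- `trF = (card ι - 1) D`, and positivity of `q` excludes fewer than two eigenvalues.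
  have htr : D ≤ trF := by
    have e : trF = Fintype.card ι * D - D := by
      rw [htrF, Finset.sum_sub_distrib, ← hD]; simp
    have hc : 2 ≤ Fintype.card ι := by
      by_contra hcon
      have := Fintype.card_le_one_iff_subsingleton.1 (by omega : Fintype.card ι ≤ 1)
      rcases isEmpty_or_nonempty ι with hι | ⟨⟨m⟩⟩
      · simp at hD; linarith
      · rw [Fintype.sum_subsingleton _ m] at hD hq
        rw [hD] at hq
        linarith
    have hc' : (2 : ℝ) ≤ Fintype.card ι := by exact_mod_cast hc
    nlinarith
  set X := ∑ a, (D - l a) * ((∑ b, T b b a) / D) ^ 2 with hX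
  have hXZ : Z / D = X := by
    rw [hZ, hX, Finset.sum_div]
    exact Finset.sum_congr rfl fun a _ => by field_simp
  have hX0 : 0 ≤ X := Finset.sum_nonneg fun a _ => mul_nonneg (hF a) (sq_nonneg _)
  set Y := ∑ a, (D - l a) * (g a / u) ^ 2 with hY
  -- By the first-order condition `α² Y ≤ 2X + 2 trF |y|²`; `α ≥ 8` yields the quarter and `2|y|² ≤
  -- α` the single `trF`.
  have hYle : α * Y ≤ X / 4 + trF := by
    have h2 : α ^ 2 * Y ≤ 2 * X + 2 * (trF * ∑ a, y a ^ 2) := by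
      rw [hY, hX, Finset.mul_sum, Finset.mul_sum, Finset.mul_sum, Finset.mul_sum,
        ← Finset.sum_add_distrib]
      refine Finset.sum_le_sum fun a _ => ?_
      have e : α * (g a / u) = -((∑ b, T b b a) / D + y a) := by linarith [hgrad a]
      have h4 : (D - l a) * (α * (g a / u)) ^ 2 ≤
          (D - l a) * (2 * ((∑ b, T b b a) / D) ^ 2 + 2 * y a ^ 2) := by
        apply mul_le_mul_of_nonneg_left _ (hF a)
        rw [e]
        nlinarith [sq_nonneg ((∑ b, T b b a) / D - y a)]
      have h5 : (D - l a) * y a ^ 2 ≤ trF * y a ^ 2 :=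
        mul_le_mul_of_nonneg_right (hFtr a) (sq_nonneg _)
      linarith
    have h6 : α * (α * Y) ≤ α * (X / 4 + trF) := by nlinarith
    exact le_of_mul_le_mul_left h6 (by linarith)
  have hFl : ∑ a, (D - l a) * l a = 2 * q := by
    have : ∑ a, (D - l a) * l a = D * ∑ a, l a - ∑ a, l a ^ 2 := by
      rw [Finset.mul_sum, ← Finset.sum_sub_distrib]
      exact Finset.sum_congr rfl fun a _ => by ring
    rw [this, ← hD]; linarith
  -- The second-order condition contracted with the nonnegative coefficients `D - l a`.
  have hsum : α * (2 * q / u - Y) + (∑ a, (D - l a) * V a) / D - X + 2 * trF ≤ 0 := by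
    have : ∑ a, (D - l a) * (α * (l a / u - (g a / u) ^ 2) + V a / D - ((∑ b, T b b a) / D) ^ 2
        + 2) ≤ 0 :=
      Finset.sum_nonpos fun a _ => mul_nonpos_of_nonneg_of_nonpos (hF a) (hhess a)
    refine le_trans (le_of_eq ?_) this
    rw [← hFl, hY, hX, htrF, Finset.sum_div, Finset.sum_div, ← Finset.sum_sub_distrib,
      Finset.mul_sum, Finset.mul_sum, ← Finset.sum_add_distrib, ← Finset.sum_sub_distrib,
      ← Finset.sum_add_distrib]
    exact Finset.sum_congr rfl fun a _ => by ring
  have hJ : q ^ 2 * (θ / D) + 5 / 4 * X ≤ (∑ a, (D - l a) * V a) / D := by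
    rw [hV, ← hXZ, mul_div_assoc', mul_div_assoc', ← add_div]
    gcongr
    linarith
  have hθ : -q ^ 2 + α * q / u ≤ q ^ 2 * (θ / D) := by
    have h7 : -1 - α * (-(1 / q) / u) ≤ θ / D := by linarith
    refine le_trans (le_of_eq ?_) (mul_le_mul_of_nonneg_left h7 (sq_nonneg q))
    field_simp
    ring
  -- The `5/4 X` of `hJ` pays for `X` in `hsum` and for `X/4` in `hYle`. Of the two copies of `trF`
  -- one remains, and it dominates `D`.
  have hfin : D ≤ -(3 * α * q / u) + q ^ 2 := by
    have e1 : α * (2 * q / u - Y) = 2 * (α * q / u) - α * Y := by ring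
    have e2 : 3 * α * q / u = 3 * (α * q / u) := by ring
    linarith
  have h8 : -u * D ≤ 3 * α * q + -u * q ^ 2 := by
    refine le_trans (mul_le_mul_of_nonneg_left hfin (by linarith)) (le_of_eq ?_)
    have hu' : u ≠ 0 := hu.ne
    have e : -u * -(3 * α * q / u) = 3 * α * q := by field_simp
    rw [mul_add, e]
  have h9 : q ^ 2 ≤ q₁ ^ 2 := by gcongr
  have h10 : -u * q ^ 2 ≤ -u * q₁ ^ 2 := mul_le_mul_of_nonneg_left h9 (by linarith)
  have h11 : 3 * α * q ≤ 3 * α * q₁ := mul_le_mul_of_nonneg_left h1 (by linarith)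
  linarith

end Jacobi

/-! ### Newton's identities up to degree three. -/

section Esymm

variable {ι : Type*} [Fintype ι]

lemma esymm_one_eq (l : ι → ℝ) : (Finset.univ.val.map l).esymm 1 = ∑ a, l a := by
  classical
  rw [← MvPolynomial.aeval_esymm_eq_multiset_esymm ι ℝ 1 l]
  simp

lemma two_mul_esymm_two (l : ι → ℝ) :
    2 * (Finset.univ.val.map l).esymm 2 = (∑ a, l a) ^ 2 - ∑ a, l a ^ 2 := by
  classical
  have h := congrArg (MvPolynomial.aeval l) (MvPolynomial.mul_esymm_eq_sum ι ℝ 2)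
  have e1 := esymm_one_eq l
  rw [← MvPolynomial.aeval_esymm_eq_multiset_esymm ι ℝ 1 l] at e1
  rw [← MvPolynomial.aeval_esymm_eq_multiset_esymm ι ℝ 2 l]
  have hs : (Finset.HasAntidiagonal.antidiagonal 2).filter (fun a : ℕ × ℕ => a.1 < 2)
      = {(0, 2), (1, 1)} := by
    decide
  rw [hs] at h
  simp [MvPolynomial.psum] at h
  have e : ∀ p : MvPolynomial ι ℝ, MvPolynomial.aeval l p = MvPolynomial.eval l p := fun p => rfl
  simp only [e]
  linarith

/-- With `D = σ₁` this reads `∑ l²(D - l) = D σ₂ - 3σ₃`, which converts a lower bound for `σ₃` into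
the hypothesis `h3` of the Jacobi inequality. -/
lemma three_mul_esymm_three (l : ι → ℝ) :
    3 * (Finset.univ.val.map l).esymm 3 =
      (Finset.univ.val.map l).esymm 2 * ∑ a, l a - (∑ a, l a) * ∑ a, l a ^ 2 + ∑ a, l a ^ 3 := by
  classical
  have h := congrArg (MvPolynomial.aeval l) (MvPolynomial.mul_esymm_eq_sum ι ℝ 3)
  have e1 := esymm_one_eq l
  rw [← MvPolynomial.aeval_esymm_eq_multiset_esymm ι ℝ 1 l] at e1
  rw [← MvPolynomial.aeval_esymm_eq_multiset_esymm ι ℝ 2 l,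
    ← MvPolynomial.aeval_esymm_eq_multiset_esymm ι ℝ 3 l]
  have hs : (Finset.HasAntidiagonal.antidiagonal 3).filter (fun a : ℕ × ℕ => a.1 < 3)
      = {(0, 3), (1, 2), (2, 1)} := by
    decide
  rw [hs] at h
  simp [MvPolynomial.psum] at h
  have e : ∀ p : MvPolynomial ι ℝ, MvPolynomial.aeval l p = MvPolynomial.eval l p := fun p => rfl
  simp only [e]
  linarith

end Esymm

/-! ### Passage to an eigenbasis of the Hessian. -/

variable {n : ℕ}

lemma exists_diagonalization {W : Matrix (Fin n) (Fin n) ℝ} (hW : ∀ i j, W i j = W j i) :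
    ∃ (l : Fin n → ℝ) (O : Fin n → Fin n → ℝ),
      (∀ a b, ∑ i, O a i * O b i = if a = b then 1 else 0) ∧
      (∀ i j, ∑ a, O a i * O a j = if i = j then 1 else 0) ∧
      (∀ i j, ∑ a, l a * (O a i * O a j) = W i j) ∧
      ∀ k, sigma k W = (Finset.univ.val.map l).esymm k := by
  have hH : W.IsHermitian := by
    ext i j
    simp [Matrix.conjTranspose_apply, hW i j]
  set U : Matrix (Fin n) (Fin n) ℝ := ↑(hH.eigenvectorUnitary) with hU
  have h1 : star U * U = 1 := Unitary.coe_star_mul_self hH.eigenvectorUnitary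
  have h2 : U * star U = 1 := Unitary.coe_mul_star_self hH.eigenvectorUnitary
  have h3 := hH.spectral_theorem
  refine ⟨hH.eigenvalues, fun a i => U i a, fun a b => ?_, fun i j => ?_, fun i j => ?_,
    fun k => ?_⟩
  · have := congrFun (congrFun h1 a) b
    simpa [Matrix.mul_apply, Matrix.star_apply, Matrix.one_apply] using this
  · have := congrFun (congrFun h2 i) j
    simpa [Matrix.mul_apply, Matrix.star_apply, Matrix.one_apply] using this
  · have := congrFun (congrFun h3 i) j
    rw [this]
    simp [Unitary.conjStarAlgAut_apply, Matrix.mul_apply, Matrix.star_apply, Matrix.diagonal_apply]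
    refine Finset.sum_congr rfl fun a _ => ?_
    simp only [hU, hH.eigenvectorUnitary_apply]
    ring
  · rw [sigma, hH.roots_charpoly_eq_eigenvalues]
    simp

section Rotation

variable {O : Fin n → Fin n → ℝ}

lemma sum_sq_rotate (h₂ : ∀ i j, ∑ a, O a i * O a j = if i = j then 1 else 0) (x : Fin n → ℝ) :
    ∑ a, (∑ i, O a i * x i) ^ 2 = ∑ i, x i ^ 2 := by
  calc ∑ a, (∑ i, O a i * x i) ^ 2
      = ∑ a, ∑ i, ∑ j, (O a i * O a j) * (x i * x j) := by
        refine Finset.sum_congr rfl fun a _ => ?_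
        rw [sq, Finset.sum_mul_sum]
        exact Finset.sum_congr rfl fun i _ => Finset.sum_congr rfl fun j _ => by ring
    _ = ∑ i, ∑ j, (∑ a, O a i * O a j) * (x i * x j) := by
        rw [Finset.sum_comm]
        refine Finset.sum_congr rfl fun i _ => ?_
        rw [Finset.sum_comm]
        exact Finset.sum_congr rfl fun j _ => by rw [Finset.sum_mul]
    _ = ∑ i, x i ^ 2 := by
        refine Finset.sum_congr rfl fun i _ => ?_
        simp [h₂, sq]

lemma sum_diag_rotate (c : Fin n → ℝ) (M : Fin n → Fin n → ℝ) :
    ∑ a, c a * ∑ i, ∑ j, O a i * O a j * M i j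
      = ∑ i, ∑ j, (∑ a, c a * (O a i * O a j)) * M i j := by
  simp_rw [Finset.mul_sum, Finset.sum_mul]
  rw [Finset.sum_comm]
  refine Finset.sum_congr rfl fun i _ => ?_
  rw [Finset.sum_comm]
  exact Finset.sum_congr rfl fun j _ => Finset.sum_congr rfl fun a _ => by ring

/-- The components of a `3`-tensor with respect to the basis `O`. -/
def rotate₃ (O : Fin n → Fin n → ℝ) (T : Fin n → Fin n → Fin n → ℝ) (a b c : Fin n) : ℝ :=
  ∑ i, O a i * ∑ j, O b j * ∑ k, O c k * T i j k

lemma rotate₃_swap₁ {T : Fin n → Fin n → Fin n → ℝ} (hT : ∀ i j k, T i j k = T j i k)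
    (a b c : Fin n) : rotate₃ O T a b c = rotate₃ O T b a c := by
  simp only [rotate₃, Finset.mul_sum]
  rw [Finset.sum_comm]
  refine Finset.sum_congr rfl fun j _ => Finset.sum_congr rfl fun i _ =>
    Finset.sum_congr rfl fun k _ => ?_
  rw [hT i j k]; ring

lemma rotate₃_swap₂ {T : Fin n → Fin n → Fin n → ℝ} (hT : ∀ i j k, T i j k = T i k j)
    (a b c : Fin n) : rotate₃ O T a b c = rotate₃ O T a c b := by
  simp only [rotate₃, Finset.mul_sum]
  refine Finset.sum_congr rfl fun i _ => ?_
  rw [Finset.sum_comm]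
  refine Finset.sum_congr rfl fun j _ => Finset.sum_congr rfl fun k _ => ?_
  rw [hT i k j]; ring

lemma sum_sq_rotate₃ (h₂ : ∀ i j, ∑ a, O a i * O a j = if i = j then 1 else 0)
    (T : Fin n → Fin n → Fin n → ℝ) :
    ∑ a, ∑ b, ∑ c, rotate₃ O T a b c ^ 2 = ∑ i, ∑ j, ∑ k, T i j k ^ 2 := by
  calc ∑ a, ∑ b, ∑ c, rotate₃ O T a b c ^ 2
      = ∑ b, ∑ c, ∑ a, rotate₃ O T a b c ^ 2 := by
        rw [Finset.sum_comm]
        exact Finset.sum_congr rfl fun b _ => Finset.sum_comm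
    _ = ∑ b, ∑ c, ∑ i, (∑ j, O b j * ∑ k, O c k * T i j k) ^ 2 := by
        simp only [rotate₃, sum_sq_rotate h₂]
    _ = ∑ i, ∑ c, ∑ b, (∑ j, O b j * ∑ k, O c k * T i j k) ^ 2 := by
        rw [Finset.sum_comm, Finset.sum_congr rfl fun c _ => Finset.sum_comm, Finset.sum_comm]
    _ = ∑ i, ∑ j, ∑ c, (∑ k, O c k * T i j k) ^ 2 := by
        refine Finset.sum_congr rfl fun i _ => ?_
        rw [Finset.sum_comm (f := fun j c => (∑ k, O c k * T i j k) ^ 2)]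
        exact Finset.sum_congr rfl fun c _ => sum_sq_rotate h₂ fun j => ∑ k, O c k * T i j k
    _ = _ := by simp only [sum_sq_rotate h₂]

/-- Needed for two choices of weights: `c = 1` gives the gradient of the trace, and `c a = S - l a`
gives the gradient of `σ₂`, both in the eigenbasis. -/
lemma sum_rotate₃_diag (c : Fin n → ℝ) (T : Fin n → Fin n → Fin n → ℝ) (k : Fin n) :
    ∑ a, c a * rotate₃ O T a a k
      = ∑ r, O k r * ∑ i, ∑ j, (∑ a, c a * (O a i * O a j)) * T i j r := by
  have : ∀ a, rotate₃ O T a a k = ∑ i, ∑ j, O a i * O a j * ∑ r, O k r * T i j r := by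
    intro a
    simp only [rotate₃, Finset.mul_sum]
    exact Finset.sum_congr rfl fun i _ => Finset.sum_congr rfl fun j _ =>
      Finset.sum_congr rfl fun r _ => by ring
  simp_rw [this]
  rw [sum_diag_rotate]
  have e : ∀ i j, (∑ a, c a * (O a i * O a j)) * ∑ r, O k r * T i j r
      = ∑ r, O k r * ((∑ a, c a * (O a i * O a j)) * T i j r) := fun i j => by
    rw [Finset.mul_sum]
    exact Finset.sum_congr rfl fun r _ => by ring
  simp_rw [e]
  rw [Finset.sum_congr rfl fun i _ => Finset.sum_comm, Finset.sum_comm]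
  refine Finset.sum_congr rfl fun r _ => ?_
  rw [Finset.mul_sum]
  refine Finset.sum_congr rfl fun i _ => ?_
  rw [Finset.mul_sum]

end Rotation

lemma sum_diagonal {W : Matrix (Fin n) (Fin n) ℝ} {l : Fin n → ℝ} {O : Fin n → Fin n → ℝ}
    (h₁ : ∀ a b, ∑ i, O a i * O b i = if a = b then 1 else 0)
    (hl : ∀ i j, ∑ a, l a * (O a i * O a j) = W i j) : ∑ i, W i i = ∑ a, l a := by
  simp_rw [← hl]
  rw [Finset.sum_comm]
  refine Finset.sum_congr rfl fun a _ => ?_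
  rw [← Finset.mul_sum, h₁ a a, if_pos rfl, mul_one]

lemma quadratic_form_eigenvector {W : Matrix (Fin n) (Fin n) ℝ} {l : Fin n → ℝ}
    {O : Fin n → Fin n → ℝ} (h₁ : ∀ a b, ∑ i, O a i * O b i = if a = b then 1 else 0)
    (hl : ∀ i j, ∑ a, l a * (O a i * O a j) = W i j) (a : Fin n) :
    ∑ i, ∑ j, O a i * O a j * W i j = l a := by
  calc ∑ i, ∑ j, O a i * O a j * W i j
      = ∑ b, l b * ∑ i, ∑ j, O b i * O b j * (O a i * O a j) := by
        rw [sum_diag_rotate]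
        simp_rw [hl]
        exact Finset.sum_congr rfl fun i _ => Finset.sum_congr rfl fun j _ => by ring
    _ = ∑ b, l b * ((∑ i, O b i * O a i) * ∑ j, O b j * O a j) := by
        refine Finset.sum_congr rfl fun b _ => ?_
        rw [Finset.sum_mul_sum]
        congr 1
        exact Finset.sum_congr rfl fun i _ => Finset.sum_congr rfl fun j _ => by ring
    _ = l a := by simp [h₁]

lemma sum_sq_entries {W : Matrix (Fin n) (Fin n) ℝ} {l : Fin n → ℝ} {O : Fin n → Fin n → ℝ}
    (h₁ : ∀ a b, ∑ i, O a i * O b i = if a = b then 1 else 0)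
    (hl : ∀ i j, ∑ a, l a * (O a i * O a j) = W i j) :
    ∑ i, ∑ j, W i j ^ 2 = ∑ a, l a ^ 2 := by
  have := sum_diag_rotate (O := O) l W
  simp_rw [quadratic_form_eigenvector h₁ hl, hl] at this
  simpa [sq] using this.symm

lemma sigma_one_eq {W : Matrix (Fin n) (Fin n) ℝ} (hW : ∀ i j, W i j = W j i) :
    sigma 1 W = ∑ i, W i i := by
  obtain ⟨l, O, h₁, -, hl, hs⟩ := exists_diagonalization hW
  rw [hs, esymm_one_eq, sum_diagonal h₁ hl]

lemma two_mul_sigma_two {W : Matrix (Fin n) (Fin n) ℝ} (hW : ∀ i j, W i j = W j i) :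
    2 * sigma 2 W = (∑ i, W i i) ^ 2 - ∑ i, ∑ j, W i j ^ 2 := by
  obtain ⟨l, O, h₁, -, hl, hs⟩ := exists_diagonalization hW
  rw [hs, two_mul_esymm_two, sum_diagonal h₁ hl, sum_sq_entries h₁ hl]

/-- The inequality at a maximum point of the test function. Here `W`, `T`, `g` are the values there
of `D²u`, `D³u`, `Du`, and `V`, `θ` are those of `D²Δu` and `(Δu)_t`. -/
lemma max_point_bound {W : Matrix (Fin n) (Fin n) ℝ} {V : Fin n → Fin n → ℝ}
    {T : Fin n → Fin n → Fin n → ℝ}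
    {g y : Fin n → ℝ} {A q₀ q₁ u α θ q S : ℝ} (hW : ∀ i j, W i j = W j i)
    (hA : 0 ≤ A) (hq₀ : 0 < q₀) (hq : q = sigma 2 W) (h0 : q₀ ≤ q) (h1 : q ≤ q₁)
    (hS : S = ∑ i, W i i) (h3 : -A ≤ sigma 3 W) (hK : jacobiThreshold A q₀ q₁ ≤ S)
    (hT₁ : ∀ i j k, T i j k = T j i k) (hT₂ : ∀ i j k, T i j k = T i k j)
    (hu : u < 0) (hα : 8 ≤ α) (hy : 2 * ∑ i, y i ^ 2 ≤ α)
    (hV : S * ∑ i, V i i - ∑ i, ∑ j, W i j * V i j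
      = q ^ 2 * θ + 2 / q * ∑ k, (S * ∑ i, T i i k - ∑ i, ∑ j, W i j * T i j k) ^ 2
        + ∑ i, ∑ j, ∑ k, T i j k ^ 2 - ∑ k, (∑ i, T i i k) ^ 2)
    (hgrad : ∀ ξ : Fin n → ℝ, α * ((∑ i, ξ i * g i) / u) + (∑ k, ξ k * ∑ i, T i i k) / S
      + ∑ i, ξ i * y i = 0)
    (hhess : ∀ ξ : Fin n → ℝ, α * ((∑ i, ∑ j, ξ i * ξ j * W i j) / u
        - ((∑ i, ξ i * g i) / u) ^ 2) + (∑ i, ∑ j, ξ i * ξ j * V i j) / S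
      - ((∑ k, ξ k * ∑ i, T i i k) / S) ^ 2 + 2 * ∑ i, ξ i ^ 2 ≤ 0)
    (ht : -1 ≤ α * (-(1 / q) / u) + θ / S) :
    -u * S ≤ 3 * α * q₁ + -u * q₁ ^ 2 := by
  obtain ⟨l, O, h₁, h₂, hl, hs⟩ := exists_diagonalization hW
  have hSl : S = ∑ a, l a := hS.trans (sum_diagonal h₁ hl)
  have hq2 : 2 * q = S ^ 2 - ∑ a, l a ^ 2 := by rw [hq, hs, two_mul_esymm_two, hSl]
  -- In the original basis the coefficients `S - l a` form the matrix `S I - W`, the derivative of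
  -- `σ₂`.
  have hcoef : ∀ i j, ∑ a, (S - l a) * (O a i * O a j) = (if i = j then S else 0) - W i j := by
    intro i j
    simp_rw [sub_mul, Finset.sum_sub_distrib, hl, ← Finset.mul_sum, h₂]
    simp
  have hcontr : ∀ M : Fin n → Fin n → ℝ,
      ∑ i, ∑ j, (∑ a, (S - l a) * (O a i * O a j)) * M i j
        = S * ∑ i, M i i - ∑ i, ∑ j, W i j * M i j := by
    intro M
    simp_rw [hcoef, sub_mul, Finset.sum_sub_distrib, ite_mul, zero_mul]
    simp [Finset.mul_sum]
  have hid : ∀ M : Fin n → Fin n → ℝ,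
      ∑ i, ∑ j, (∑ a, 1 * (O a i * O a j)) * M i j = ∑ i, M i i := by
    intro M
    simp [h₂]
  have htr : ∀ k, ∑ a, rotate₃ O T a a k = ∑ r, O k r * ∑ i, T i i r := by
    intro k
    have := sum_rotate₃_diag (O := O) (fun _ => 1) T k
    simp only [hid] at this
    simpa only [one_mul] using this
  have hf : ∀ k, ∑ a, (S - l a) * rotate₃ O T a a k
      = ∑ r, O k r * (S * ∑ i, T i i r - ∑ i, ∑ j, W i j * T i j r) := by
    intro k
    rw [sum_rotate₃_diag]
    exact Finset.sum_congr rfl fun r _ => by rw [hcontr fun i j => T i j r]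
  refine diag_max_point_bound (l := l) (T := rotate₃ O T) (g := fun a => ∑ i, O a i * g i)
    (y := fun a => ∑ i, O a i * y i) (V := fun a => ∑ i, ∑ j, O a i * O a j * V i j)
    hA hq₀ h0 h1 hSl (by linarith) ?_ hK (rotate₃_swap₁ hT₁) (rotate₃_swap₂ hT₂) hu hα ?_ ?_
    (fun a => ?_) (fun a => ?_) ht
  · have h3' := three_mul_esymm_three l
    rw [← hs 3, ← hs 2, ← hq, ← hSl] at h3'
    have : ∑ a, l a ^ 2 * (S - l a) = S * ∑ a, l a ^ 2 - ∑ a, l a ^ 3 := by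
      rw [Finset.mul_sum, ← Finset.sum_sub_distrib]
      exact Finset.sum_congr rfl fun a _ => by ring
    rw [this]
    linarith
  · rw [sum_sq_rotate h₂]; exact hy
  · simp_rw [htr, hf]
    rw [sum_sq_rotate h₂, sum_sq_rotate h₂, sum_sq_rotate₃ h₂, sum_diag_rotate, hcontr]
    exact hV
  · rw [htr]
    exact hgrad (O a)
  · rw [htr]
    have := hhess (O a)
    rw [quadratic_form_eigenvector h₁ hl] at this
    have h5 : ∑ i, O a i ^ 2 = 1 := by simpa [sq] using h₁ a a
    rw [h5, mul_one] at this
    exact this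

/-! ### Calculus from the existence and continuity of partial derivatives. -/

section Calculus

/-- Equality of the mixed second derivatives of a function of two real variables. -/
lemma mixed_deriv_eq {g ga gb gab gba : ℝ → ℝ → ℝ} {r : ℝ} (hr : 0 < r)
    (ha : ∀ a b, |a| < r → |b| < r → HasDerivAt (fun s => g s b) (ga a b) a)
    (hb : ∀ a b, |a| < r → |b| < r → HasDerivAt (fun s => g a s) (gb a b) b)
    (hab : ∀ a b, |a| < r → |b| < r → HasDerivAt (fun s => ga a s) (gab a b) b)
    (hba : ∀ a b, |a| < r → |b| < r → HasDerivAt (fun s => gb s b) (gba a b) a)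
    (cab : ContinuousAt (fun z : ℝ × ℝ => gab z.1 z.2) (0, 0))
    (cba : ContinuousAt (fun z : ℝ × ℝ => gba z.1 z.2) (0, 0)) : gab 0 0 = gba 0 0 := by
  -- The second difference of `g` over the square of side `h` is evaluated by the mean value theorem
  -- in both orders.
  have key : ∀ h, 0 < h → h < r → ∃ a ∈ Ioo 0 h, ∃ b ∈ Ioo 0 h, ∃ a' ∈ Ioo 0 h, ∃ b' ∈ Ioo 0 h,
      gab a b = gba a' b' := by
    intro h hh hhr
    have habs : ∀ s ∈ Icc 0 h, |s| < r := fun s hs => by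
      rw [abs_of_nonneg hs.1]; exact lt_of_le_of_lt hs.2 hhr
    have h0 : |(0 : ℝ)| < r := by simpa using hr
    have hhm : |h| < r := habs h ⟨hh.le, le_rfl⟩
    have d1 : ∀ s ∈ Icc 0 h, HasDerivAt (fun s => g s h - g s 0) (ga s h - ga s 0) s :=
      fun s hs => (ha s h (habs s hs) hhm).sub (ha s 0 (habs s hs) h0)
    obtain ⟨a, hae, ea⟩ := exists_hasDerivAt_eq_slope (fun s => g s h - g s 0)
      (fun s => ga s h - ga s 0) hh (fun s hs => (d1 s hs).continuousAt.continuousWithinAt)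
      (fun s hs => d1 s (Ioo_subset_Icc_self hs))
    have hae' := habs a (Ioo_subset_Icc_self hae)
    obtain ⟨b, hbe, eb⟩ := exists_hasDerivAt_eq_slope (fun s => ga a s) (fun s => gab a s) hh
      (fun s hs => (hab a s hae' (habs s hs)).continuousAt.continuousWithinAt)
      (fun s hs => hab a s hae' (habs s (Ioo_subset_Icc_self hs)))
    have d2 : ∀ s ∈ Icc 0 h, HasDerivAt (fun s => g h s - g 0 s) (gb h s - gb 0 s) s :=
      fun s hs => (hb h s hhm (habs s hs)).sub (hb 0 s h0 (habs s hs))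
    obtain ⟨b', hbe', eb'⟩ := exists_hasDerivAt_eq_slope (fun s => g h s - g 0 s)
      (fun s => gb h s - gb 0 s) hh (fun s hs => (d2 s hs).continuousAt.continuousWithinAt)
      (fun s hs => d2 s (Ioo_subset_Icc_self hs))
    have hbb := habs b' (Ioo_subset_Icc_self hbe')
    obtain ⟨a', hae'', ea'⟩ := exists_hasDerivAt_eq_slope (fun s => gb s b') (fun s => gba s b') hh
      (fun s hs => (hba s b' (habs s hs) hbb).continuousAt.continuousWithinAt)
      (fun s hs => hba s b' (habs s (Ioo_subset_Icc_self hs)) hbb)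
    refine ⟨a, hae, b, hbe, a', hae'', b', hbe', ?_⟩
    simp only [sub_zero] at ea eb ea' eb'
    rw [eb, ea', ea, eb']
    congr 2
    ring
  by_contra hne
  have hpos : 0 < |gab 0 0 - gba 0 0| := abs_pos.2 (sub_ne_zero.2 hne)
  obtain ⟨δ₁, hδ₁, H₁⟩ := Metric.continuousAt_iff.1 cab _ (half_pos hpos)
  obtain ⟨δ₂, hδ₂, H₂⟩ := Metric.continuousAt_iff.1 cba _ (half_pos hpos)
  set h := min (r / 2) (min δ₁ δ₂) with hh
  have hhpos : 0 < h := by positivity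
  obtain ⟨a, hae, b, hbe, a', hae', b', hbe', e⟩ := key h hhpos
    (lt_of_le_of_lt (min_le_left _ _) (by linarith))
  have hd : ∀ a ∈ Ioo 0 h, ∀ b ∈ Ioo 0 h, dist ((a, b) : ℝ × ℝ) (0, 0) < h := by
    intro a ha b hb
    rw [Prod.dist_eq, max_lt_iff]
    simp only [Real.dist_eq, sub_zero]
    rw [abs_of_pos ha.1, abs_of_pos hb.1]
    exact ⟨ha.2, hb.2⟩
  have g1 := H₁ (lt_of_lt_of_le (hd a hae b hbe) ((min_le_right _ _).trans (min_le_left _ _)))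
  have g2 := H₂ (lt_of_lt_of_le (hd a' hae' b' hbe') ((min_le_right _ _).trans (min_le_right _ _)))
  simp only [Real.dist_eq] at g1 g2
  rw [e] at g1
  have := abs_sub_le (gab 0 0) (gba a' b') (gba 0 0)
  rw [abs_sub_comm (gab 0 0) (gba a' b')] at this
  linarith

/-- Second derivative test: a necessary condition for a local maximum. -/
lemma deriv_conditions_of_isLocalMax {g g' : ℝ → ℝ} {c : ℝ} (hmax : IsLocalMax g 0)
    (hg : ∀ᶠ s in 𝓝 0, HasDerivAt g (g' s) s) (hg' : HasDerivAt g' c 0) :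
    g' 0 = 0 ∧ c ≤ 0 := by
  have h0 : g' 0 = 0 := hmax.hasDerivAt_eq_zero hg.self_of_nhds
  refine ⟨h0, ?_⟩
  by_contra! hc
  have hd : deriv g =ᶠ[𝓝 0] g' := hg.mono fun s hs => hs.deriv
  have hdd : deriv (deriv g) 0 = c := by rw [hd.deriv_eq]; exact hg'.deriv
  have hmin : IsLocalMin g 0 := isLocalMin_of_deriv_deriv_pos (by rw [hdd]; exact hc)
    (by rw [hd.self_of_nhds, h0]) hg.self_of_nhds.continuousAt
  -- If `c > 0`, the point is also a local minimum, so `g` is locally constant and its second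
  -- derivative vanishes.
  have hconst : g =ᶠ[𝓝 0] fun _ => g 0 := by
    filter_upwards [hmin, hmax] with s h1 h2 using le_antisymm h2 h1
  have hd0 : deriv g =ᶠ[𝓝 0] fun _ => 0 := by
    have := hconst.deriv
    simpa using this
  have : deriv (deriv g) 0 = 0 := by rw [hd0.deriv_eq]; simp
  linarith

/-- A function with continuous partial derivatives is differentiable. -/
lemma hasFDerivAt_of_partials {h : EuclideanSpace ℝ (Fin n) → ℝ}
    {h' : Fin n → EuclideanSpace ℝ (Fin n) → ℝ} {x : EuclideanSpace ℝ (Fin n)}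
    (hd : ∀ᶠ y in 𝓝 x, ∀ i,
      HasDerivAt (fun s : ℝ => h (y + s • EuclideanSpace.single i 1)) (h' i y) 0)
    (hc : ∀ i, ContinuousAt (h' i) x) :
    HasFDerivAt h (∑ i, h' i x • (EuclideanSpace.proj i : EuclideanSpace ℝ (Fin n) →L[ℝ] ℝ)) x := by
  set P : Finset (Fin n) → EuclideanSpace ℝ (Fin n) → EuclideanSpace ℝ (Fin n) :=
    fun S z => ∑ i ∈ S, z i • EuclideanSpace.single i (1 : ℝ) with hP
  have hPn : ∀ S z, ‖P S z‖ ≤ n * ‖z‖ := by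
    intro S z
    calc ‖P S z‖ ≤ ∑ i ∈ S, ‖z i • EuclideanSpace.single i (1 : ℝ)‖ := norm_sum_le _ _
      _ ≤ ∑ i ∈ S, ‖z‖ := Finset.sum_le_sum fun i _ => by
          rw [norm_smul]; simpa using PiLp.norm_apply_le z i
      _ = S.card * ‖z‖ := by simp
      _ ≤ n * ‖z‖ := by
          gcongr
          simpa using Finset.card_le_univ S
  -- The coordinates in `S` are switched on one at a time; each step is a mean value estimate along
  -- an edge, with error controlled by the continuity of one partial derivative at `x`.
  have key : ∀ S : Finset (Fin n), (fun z : EuclideanSpace ℝ (Fin n) =>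
      h (x + P S z) - h x - ∑ i ∈ S, h' i x * z i) =o[𝓝 0] fun z => z := by
    intro S
    induction S using Finset.induction_on with
    | empty => simp [hP]
    | insert j S hj ih =>
      have step : (fun z : EuclideanSpace ℝ (Fin n) =>
          h (x + P (insert j S) z) - h (x + P S z) - h' j x * z j) =o[𝓝 0] fun z => z := by
        rw [Asymptotics.isLittleO_iff]
        intro ε hε
        have hball := (hd.and (Metric.continuousAt_iff'.1 (hc j) ε hε))
        obtain ⟨δ, hδ, H⟩ := Metric.eventually_nhds_iff.1 hball
        have hsmall : ∀ᶠ z : EuclideanSpace ℝ (Fin n) in 𝓝 0, (n + 1) * ‖z‖ < δ := by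
          have : Tendsto (fun z : EuclideanSpace ℝ (Fin n) => ((n : ℝ) + 1) * ‖z‖) (𝓝 0)
              (𝓝 (((n : ℝ) + 1) * ‖(0 : EuclideanSpace ℝ (Fin n))‖)) :=
            (continuous_const.mul continuous_norm).tendsto 0
          rw [norm_zero, mul_zero] at this
          exact this.eventually_lt_const hδ
        filter_upwards [hsmall] with z hz
        have hzj : |z j| ≤ ‖z‖ := by simpa using PiLp.norm_apply_le z j
        set G : ℝ → ℝ := fun s => h (x + P S z + s • EuclideanSpace.single j 1) - s * h' j x with hG
        have hmem : ∀ s ∈ uIcc 0 (z j), dist (x + P S z + s • EuclideanSpace.single j 1) x < δ := by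
          intro s hs
          have hs' : |s| ≤ |z j| := by
            have := abs_sub_left_of_mem_uIcc hs
            simpa using this
          rw [dist_eq_norm, add_assoc, add_sub_cancel_left]
          refine lt_of_le_of_lt (norm_add_le _ _) ?_
          have : ‖s • (EuclideanSpace.single j 1 : EuclideanSpace ℝ (Fin n))‖ ≤ ‖z‖ := by
            rw [norm_smul]; simpa using hs'.trans hzj
          linarith [hPn S z]
        have hderiv : ∀ s ∈ uIcc 0 (z j), HasDerivWithinAt G
            (h' j (x + P S z + s • EuclideanSpace.single j 1) - h' j x) (uIcc 0 (z j)) s := by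
          intro s hs
          have h1 := (H (hmem s hs)).1 j
          have h2 : HasDerivAt (fun r : ℝ => h (x + P S z + r • EuclideanSpace.single j 1))
              (h' j (x + P S z + s • EuclideanSpace.single j 1)) s := by
            have h3 := HasDerivAt.comp_sub_const (x := s) s
              (f := fun r : ℝ => h (x + P S z + s • EuclideanSpace.single j 1
                + r • EuclideanSpace.single j 1))
              (f' := h' j (x + P S z + s • EuclideanSpace.single j 1)) (by simpa using h1)
            refine h3.congr_of_eventuallyEq (Eventually.of_forall fun r => ?_)
            simp only
            congr 1
            rw [add_assoc (x + P S z), ← add_smul]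
            congr 2
            ring
          exact (h2.sub (by simpa using (hasDerivAt_id s).mul_const (h' j x))).hasDerivWithinAt
        have hbound : ∀ s ∈ uIcc 0 (z j),
            ‖h' j (x + P S z + s • EuclideanSpace.single j 1) - h' j x‖ ≤ ε := by
          intro s hs
          have := (H (hmem s hs)).2
          rw [dist_eq_norm] at this
          exact this.le
        have hmv := Convex.norm_image_sub_le_of_norm_hasDerivWithin_le hderiv hbound
          (convex_uIcc _ _) left_mem_uIcc right_mem_uIcc
        have e : G (z j) - G 0 = h (x + P (insert j S) z) - h (x + P S z) - h' j x * z j := by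
          simp only [hG, hP, Finset.sum_insert hj]
          rw [add_comm (z j • _), ← add_assoc]
          simp
          ring
        rw [← e]
        refine hmv.trans ?_
        gcongr
        simpa using hzj
      refine (ih.add step).congr_left fun z => ?_
      rw [Finset.sum_insert hj]
      ring
  rw [hasFDerivAt_iff_isLittleO_nhds_zero]
  refine (key Finset.univ).congr_left fun z => ?_
  have e : P Finset.univ z = z := by
    ext k
    simp [hP, Pi.single_apply]
  rw [e]
  simp

end Calculus

/-! ### Derivatives of functions of class `ParabolicDiff`. -/

variable {Ω : Set (SpaceTime n)}

lemma IsRelOpen.eventually_slice (hΩ : IsRelOpen Ω) {x : EuclideanSpace ℝ (Fin n)} {t : ℝ}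
    (h : (x, t) ∈ Ω) : ∀ᶠ y in 𝓝 x, (y, t) ∈ Ω := by
  obtain ⟨V, hV, rfl⟩ := hΩ
  have hc : ContinuousAt (fun y : EuclideanSpace ℝ (Fin n) => (y, t)) x := by fun_prop
  filter_upwards [hc (hV.mem_nhds h.1)] with y hy using ⟨hy, h.2⟩

lemma IsRelOpen.mem_nhds (hΩ : IsRelOpen Ω) {p : SpaceTime n} (h : p ∈ Ω) (ht : p.2 < 0) :
    Ω ∈ 𝓝 p := by
  obtain ⟨V, hV, rfl⟩ := hΩ
  have : {p : SpaceTime n | p.2 < 0} ∈ 𝓝 p := (isOpen_lt continuous_snd continuous_const).mem_nhds ht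
  filter_upwards [hV.mem_nhds h.1, this] with y hy hy' using ⟨hy, le_of_lt hy'⟩

lemma ParabolicDiff.extendsCont {w : SpaceTime n → ℝ} : ∀ {k : ℕ}, ParabolicDiff Ω k w →
    ExtendsCont Ω w
  | 0, h => h
  | 1, h => h.1
  | _ + 2, h => h.1

lemma ExtendsCont.continuousOn {w : SpaceTime n → ℝ} (h : ExtendsCont Ω w) : ContinuousOn w Ω := by
  obtain ⟨v, hv, e⟩ := h
  exact (hv.mono subset_closure).congr e.symm

lemma ParabolicDiff.hasDx {w : SpaceTime n → ℝ} : ∀ {k : ℕ}, ParabolicDiff Ω (k + 1) w →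
    ∀ i, HasDx Ω i w
  | 0, h, i => (h.2 i).1
  | _ + 1, h, i => (h.2.1 i).1

lemma ParabolicDiff.dx {w : SpaceTime n → ℝ} : ∀ {k : ℕ}, ParabolicDiff Ω (k + 1) w →
    ∀ i, ParabolicDiff Ω k (dx i w)
  | 0, h, i => (h.2 i).2
  | _ + 1, h, i => (h.2.1 i).2

lemma ParabolicDiff.hasDt {w : SpaceTime n → ℝ} {k : ℕ} (h : ParabolicDiff Ω (k + 2) w) :
    HasDt Ω w := h.2.2.1

lemma ParabolicDiff.dt {w : SpaceTime n → ℝ} {k : ℕ} (h : ParabolicDiff Ω (k + 2) w) :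
    ParabolicDiff Ω k (dt w) := h.2.2.2

lemma HasDx.hasDerivAt {w : SpaceTime n → ℝ} {i : Fin n} (h : HasDx Ω i w)
    {x : EuclideanSpace ℝ (Fin n)} {t s : ℝ}
    (hs : (x + s • EuclideanSpace.single i (1 : ℝ), t) ∈ Ω) :
    HasDerivAt (fun r : ℝ => w (x + r • EuclideanSpace.single i 1, t))
      (ParabolicHessian.dx i w (x + s • EuclideanSpace.single i 1, t)) s := by
  have h1 := (h _ hs).hasLineDerivAt
  unfold HasLineDerivAt at h1
  have h3 := HasDerivAt.comp_sub_const (x := s) s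
    (f := fun r : ℝ => w (x + s • EuclideanSpace.single i 1 + r • EuclideanSpace.single i 1, t))
    (by simpa using h1)
  refine h3.congr_of_eventuallyEq (Eventually.of_forall fun r => ?_)
  simp only
  rw [add_assoc x, ← add_smul]
  congr 4
  ring

lemma HasDt.hasDerivAt {w : SpaceTime n → ℝ} (h : HasDt Ω w) {p : SpaceTime n} (hp : p ∈ Ω)
    (ht : p.2 < 0) : HasDerivAt (fun s => w (p.1, s)) (ParabolicHessian.dt w p) p.2 :=
  (h p hp).hasDerivWithinAt.hasDerivAt (Iic_mem_nhds ht)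

lemma dx_congr (hΩ : IsRelOpen Ω) {v w : SpaceTime n → ℝ} (h : EqOn v w Ω) (i : Fin n) :
    EqOn (dx i v) (dx i w) Ω := by
  rintro ⟨x, t⟩ hp
  refine EventuallyEq.lineDeriv_eq ?_
  filter_upwards [hΩ.eventually_slice hp] with y hy using h hy

/-- The class only provides coordinate derivatives, whereas the maximum conditions are needed along
eigenvectors of the Hessian. -/
lemma ParabolicDiff.hasDerivAt_line (hΩ : IsRelOpen Ω) {w : SpaceTime n → ℝ}
    (hw : ParabolicDiff Ω 1 w) (x ξ : EuclideanSpace ℝ (Fin n)) {t s : ℝ}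
    (hs : (x + s • ξ, t) ∈ Ω) :
    HasDerivAt (fun r : ℝ => w (x + r • ξ, t))
      (∑ i, ξ i * ParabolicHessian.dx i w (x + s • ξ, t)) s := by
  have hF := hasFDerivAt_of_partials (h := fun y => w (y, t))
    (h' := fun i y => ParabolicHessian.dx i w (y, t)) (x := x + s • ξ)
    (by
      filter_upwards [hΩ.eventually_slice hs] with y hy i
      have := (hw.hasDx i).hasDerivAt (x := y) (t := t) (s := 0) (by simpa using hy)
      simpa using this)
    (fun i => by
      have h1 := (hw.dx i).extendsCont.continuousOn _ hs
      have h2 : Tendsto (fun y : EuclideanSpace ℝ (Fin n) => (y, t)) (𝓝 (x + s • ξ))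
          (𝓝[Ω] (x + s • ξ, t)) :=
        tendsto_nhdsWithin_iff.2
          ⟨Continuous.tendsto (by fun_prop) _, hΩ.eventually_slice hs⟩
      exact h1.tendsto.comp h2)
  have hline : HasDerivAt (fun r : ℝ => x + r • ξ) ξ s := by
    simpa using ((hasDerivAt_id s).smul_const ξ).const_add x
  have := hF.comp_hasDerivAt s hline
  refine this.congr_deriv ?_
  simp [mul_comm]

lemma ParabolicDiff.hasDerivAt_line₂ (hΩ : IsRelOpen Ω) {w : SpaceTime n → ℝ}
    (hw : ParabolicDiff Ω 2 w) (x ξ : EuclideanSpace ℝ (Fin n)) {t s : ℝ}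
    (hs : (x + s • ξ, t) ∈ Ω) :
    HasDerivAt (fun r : ℝ => ∑ i, ξ i * ParabolicHessian.dx i w (x + r • ξ, t))
      (∑ i, ∑ j, ξ i * ξ j * ParabolicHessian.dx j (ParabolicHessian.dx i w) (x + s • ξ, t)) s := by
  refine HasDerivAt.fun_sum fun i _ => ?_
  refine (((hw.dx i).hasDerivAt_line hΩ x ξ hs).const_mul (ξ i)).congr_deriv ?_
  rw [Finset.mul_sum]
  exact Finset.sum_congr rfl fun j _ => by ring

lemma eventually_line_mem (hΩ : IsRelOpen Ω) {x : EuclideanSpace ℝ (Fin n)} {t : ℝ}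
    (h : (x, t) ∈ Ω) (ξ : EuclideanSpace ℝ (Fin n)) : ∀ᶠ s : ℝ in 𝓝 0, (x + s • ξ, t) ∈ Ω := by
  have : Tendsto (fun s : ℝ => x + s • ξ) (𝓝 0) (𝓝 x) := by
    have : Continuous fun s : ℝ => x + s • ξ := by fun_prop
    simpa using this.tendsto 0
  exact this.eventually (hΩ.eventually_slice h)

lemma ParabolicDiff.dx_comm (hΩ : IsRelOpen Ω) {w : SpaceTime n → ℝ} (hw : ParabolicDiff Ω 2 w)
    (i j : Fin n) : EqOn (ParabolicHessian.dx i (ParabolicHessian.dx j w))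
      (ParabolicHessian.dx j (ParabolicHessian.dx i w)) Ω := by
  rintro ⟨x, t⟩ hp
  set L : ℝ × ℝ → SpaceTime n := fun z =>
    (x + z.1 • EuclideanSpace.single i (1 : ℝ) + z.2 • EuclideanSpace.single j (1 : ℝ), t) with hL
  have hLc : Continuous L := by fun_prop
  have hL0 : L (0, 0) = (x, t) := by simp [hL]
  have hev : ∀ᶠ z in 𝓝 ((0 : ℝ), (0 : ℝ)), L z ∈ Ω := by
    have : Tendsto (fun z : ℝ × ℝ => x + z.1 • EuclideanSpace.single i (1 : ℝ)
        + z.2 • EuclideanSpace.single j (1 : ℝ)) (𝓝 (0, 0)) (𝓝 x) := by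
      have : Continuous (fun z : ℝ × ℝ => x + z.1 • EuclideanSpace.single i (1 : ℝ)
        + z.2 • EuclideanSpace.single j (1 : ℝ)) := by fun_prop
      simpa using this.tendsto (0, 0)
    exact this.eventually (hΩ.eventually_slice hp)
  obtain ⟨r, hr, H⟩ := Metric.eventually_nhds_iff.1 hev
  have H' : ∀ a b, |a| < r → |b| < r → L (a, b) ∈ Ω := fun a b ha hb => H (by
    rw [Prod.dist_eq, max_lt_iff]; simpa [Real.dist_eq] using ⟨ha, hb⟩)
  have hLcomm : ∀ a b, L (a, b) = (x + b • EuclideanSpace.single j (1 : ℝ)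
      + a • EuclideanSpace.single i (1 : ℝ), t) := fun a b => by
    simp only [hL]; rw [add_right_comm]
  have hcont : ∀ v : SpaceTime n → ℝ, ContinuousOn v Ω →
      ContinuousAt (fun z : ℝ × ℝ => v (L (z.1, z.2))) (0, 0) := by
    intro v hv
    have h2 : Tendsto L (𝓝 (0, 0)) (𝓝[Ω] (L (0, 0))) :=
      tendsto_nhdsWithin_iff.2 ⟨hLc.tendsto _, hev⟩
    exact (hv _ (by rw [hL0]; exact hp)).tendsto.comp h2
  have := mixed_deriv_eq (g := fun a b => w (L (a, b)))
    (ga := fun a b => ParabolicHessian.dx i w (L (a, b)))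
    (gb := fun a b => ParabolicHessian.dx j w (L (a, b)))
    (gab := fun a b => ParabolicHessian.dx j (ParabolicHessian.dx i w) (L (a, b)))
    (gba := fun a b => ParabolicHessian.dx i (ParabolicHessian.dx j w) (L (a, b))) hr
    (fun a b ha hb => by
      have h := H' a b ha hb
      simp only [hLcomm] at h ⊢
      exact (hw.hasDx i).hasDerivAt h)
    (fun a b ha hb => (hw.hasDx j).hasDerivAt (H' a b ha hb))
    (fun a b ha hb => ((hw.dx i).hasDx j).hasDerivAt (H' a b ha hb))
    (fun a b ha hb => by
      have h := H' a b ha hb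
      simp only [hLcomm] at h ⊢
      exact ((hw.dx j).hasDx i).hasDerivAt h)
    (hcont _ ((hw.dx i).dx j).extendsCont.continuousOn)
    (hcont _ ((hw.dx j).dx i).extendsCont.continuousOn)
  rw [hL0] at this
  exact this.symm

/-- Restricted to negative times, where the time derivative is two-sided and `mixed_deriv_eq`
applies on a full square. -/
lemma ParabolicDiff.dx_dt_comm (hΩ : IsRelOpen Ω) {w : SpaceTime n → ℝ} (hw : ParabolicDiff Ω 3 w)
    (i : Fin n) {p : SpaceTime n} (hp : p ∈ Ω) (ht : p.2 < 0) :
    ParabolicHessian.dx i (ParabolicHessian.dt w) p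
      = ParabolicHessian.dt (ParabolicHessian.dx i w) p := by
  obtain ⟨x, t⟩ := p
  simp only at ht
  set L : ℝ × ℝ → SpaceTime n := fun z =>
    (x + z.1 • EuclideanSpace.single i (1 : ℝ), t + z.2) with hL
  have hLc : Continuous L := by fun_prop
  have hL0 : L (0, 0) = (x, t) := by simp [hL]
  have hev : ∀ᶠ z in 𝓝 ((0 : ℝ), (0 : ℝ)), L z ∈ Ω ∧ (L z).2 < 0 := by
    have h1 : Tendsto L (𝓝 (0, 0)) (𝓝 (x, t)) := by
      rw [← hL0]; exact hLc.tendsto _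
    have h2 : ∀ᶠ q : SpaceTime n in 𝓝 (x, t), q ∈ Ω ∧ q.2 < 0 := by
      filter_upwards [hΩ.mem_nhds hp ht, (isOpen_lt continuous_snd continuous_const).mem_nhds ht]
        with q h1 h2 using ⟨h1, h2⟩
    exact h1.eventually h2
  obtain ⟨r, hr, H⟩ := Metric.eventually_nhds_iff.1 hev
  have H' : ∀ a b, |a| < r → |b| < r → L (a, b) ∈ Ω ∧ (L (a, b)).2 < 0 := fun a b ha hb => H (by
    rw [Prod.dist_eq, max_lt_iff]; simpa [Real.dist_eq] using ⟨ha, hb⟩)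
  have hcont : ∀ v : SpaceTime n → ℝ, ContinuousOn v Ω →
      ContinuousAt (fun z : ℝ × ℝ => v (L (z.1, z.2))) (0, 0) := by
    intro v hv
    have h2 : Tendsto L (𝓝 (0, 0)) (𝓝[Ω] (L (0, 0))) :=
      tendsto_nhdsWithin_iff.2 ⟨hLc.tendsto _, hev.mono fun z hz => hz.1⟩
    exact (hv _ (by rw [hL0]; exact hp)).tendsto.comp h2
  have htime : ∀ v : SpaceTime n → ℝ, HasDt Ω v → ∀ a b, |a| < r → |b| < r →
      HasDerivAt (fun s => v (L (a, s))) (ParabolicHessian.dt v (L (a, b))) b := by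
    intro v hv a b ha hb
    have h := H' a b ha hb
    exact (hv.hasDerivAt h.1 h.2).comp_const_add t b
  have := mixed_deriv_eq (g := fun a b => w (L (a, b)))
    (ga := fun a b => ParabolicHessian.dx i w (L (a, b)))
    (gb := fun a b => ParabolicHessian.dt w (L (a, b)))
    (gab := fun a b => ParabolicHessian.dt (ParabolicHessian.dx i w) (L (a, b)))
    (gba := fun a b => ParabolicHessian.dx i (ParabolicHessian.dt w) (L (a, b))) hr
    (fun a b ha hb => (hw.hasDx i).hasDerivAt (H' a b ha hb).1)
    (htime _ hw.hasDt) (htime _ (hw.dx i).hasDt)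
    (fun a b ha hb => (hw.dt.hasDx i).hasDerivAt (H' a b ha hb).1)
    (hcont _ (hw.dx i).dt.extendsCont.continuousOn)
    (hcont _ (hw.dt.dx i).extendsCont.continuousOn)
  rw [hL0] at this
  exact this.symm

/-! ### The equation differentiated twice. -/

variable {u : SpaceTime n → ℝ}

/-- The spatial Laplacian `Δu`. -/
def lap (u : SpaceTime n → ℝ) (p : SpaceTime n) : ℝ := ∑ i, dx i (dx i u) p

lemma ParabolicDiff.of_succ {w : SpaceTime n → ℝ} : ∀ {k : ℕ}, ParabolicDiff Ω (k + 1) w →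
    ParabolicDiff Ω k w
  | 0, h => h.extendsCont
  | 1, h => ⟨h.extendsCont, fun i => ⟨h.hasDx i, (h.dx i).extendsCont⟩⟩
  | 2, h => ⟨h.extendsCont, fun i => ⟨h.hasDx i, (h.dx i).of_succ⟩, h.hasDt, h.dt.extendsCont⟩
  | _ + 3, h => ⟨h.extendsCont, fun i => ⟨h.hasDx i, (h.dx i).of_succ⟩, h.hasDt, h.dt.of_succ⟩

lemma hess_symm (hΩ : IsRelOpen Ω) (hu : IsC42 Ω u) {p : SpaceTime n} (hp : p ∈ Ω) (i j : Fin n) :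
    hess u p i j = hess u p j i :=
  hu.2.of_succ.of_succ.dx_comm hΩ i j hp

/-- Commuting `dx` with `dt` is known only for `t < 0`; this allows `dx_congr` to use it under a
further spatial derivative. -/
lemma IsRelOpen.inter_neg (hΩ : IsRelOpen Ω) : IsRelOpen (Ω ∩ {p | p.2 < 0}) := by
  obtain ⟨V, hV, rfl⟩ := hΩ
  refine ⟨V ∩ {p | p.2 < 0}, hV.inter (isOpen_lt continuous_snd continuous_const), ?_⟩
  ext p
  simp only [mem_inter_iff, mem_ofPred_eq]
  tauto

lemma third_deriv_swap₁ (hΩ : IsRelOpen Ω) (hu : ParabolicDiff Ω 2 u) (i j k : Fin n) :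
    EqOn (dx k (dx i (dx j u))) (dx k (dx j (dx i u))) Ω :=
  dx_congr hΩ (hu.dx_comm hΩ i j) k

lemma third_deriv_swap₂ (hΩ : IsRelOpen Ω) (hu : ParabolicDiff Ω 3 u) (i j k : Fin n) :
    EqOn (dx k (dx i (dx j u))) (dx j (dx i (dx k u))) Ω := fun p hp => by
  rw [(hu.dx j).dx_comm hΩ k i hp, dx_congr hΩ (hu.of_succ.dx_comm hΩ k j) i hp,
    (hu.dx k).dx_comm hΩ i j hp]

lemma fourth_deriv_swap (hΩ : IsRelOpen Ω) (hu : ParabolicDiff Ω 4 u) (i j k : Fin n) :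
    EqOn (dx k (dx k (dx i (dx j u)))) (dx j (dx i (dx k (dx k u)))) Ω := fun p hp => by
  rw [dx_congr hΩ ((hu.dx j).of_succ.dx_comm hΩ k i) k hp,
    ((hu.dx j).dx k).dx_comm hΩ k i hp,
    dx_congr hΩ (third_deriv_swap₁ hΩ hu.of_succ.of_succ k j k) i hp,
    dx_congr hΩ ((hu.dx k).of_succ.dx_comm hΩ k j) i hp,
    ((hu.dx k).dx k).dx_comm hΩ i j hp]

lemma dt_dx_dx_eq (hΩ : IsRelOpen Ω) (hu : ParabolicDiff Ω 4 u) (k : Fin n) {p : SpaceTime n}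
    (hp : p ∈ Ω) (ht : p.2 < 0) : dx k (dx k (dt u)) p = dt (dx k (dx k u)) p := by
  have h : EqOn (dx k (dt u)) (dt (dx k u)) (Ω ∩ {p | p.2 < 0}) := fun q hq =>
    hu.of_succ.dx_dt_comm hΩ k hq.1 hq.2
  rw [dx_congr hΩ.inter_neg h k ⟨hp, ht⟩, (hu.dx k).dx_dt_comm hΩ k hp ht]

lemma ParabolicDiff.hasDerivAt_dx {w : SpaceTime n → ℝ} {m : ℕ} (hw : ParabolicDiff Ω (m + 1) w)
    (k : Fin n) {x : EuclideanSpace ℝ (Fin n)} {t : ℝ} (hp : (x, t) ∈ Ω) :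
    HasDerivAt (fun s : ℝ => w (x + s • EuclideanSpace.single k 1, t))
      (ParabolicHessian.dx k w (x, t)) 0 := by
  simpa using (hw.hasDx k).hasDerivAt (x := x) (t := t) (s := 0) (by simpa using hp)

lemma deriv_eq_zero_of_const (hΩ : IsRelOpen Ω) {F : SpaceTime n → ℝ} {c d : ℝ} {k : Fin n}
    (hF : ∀ p ∈ Ω, F p = c) {x : EuclideanSpace ℝ (Fin n)} {t : ℝ} (hp : (x, t) ∈ Ω)
    (hd : HasDerivAt (fun s : ℝ => F (x + s • EuclideanSpace.single k 1, t)) d 0) : d = 0 := by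
  refine hd.unique ((hasDerivAt_const (0 : ℝ) c).congr_of_eventuallyEq ?_)
  filter_upwards [eventually_line_mem hΩ hp (EuclideanSpace.single k 1)] with s hs using hF _ hs

/-- The derivative of an equation `τ ((tr w)² - |w|²) = c` in a direction `xₖ`. -/
lemma equation_dx (hΩ : IsRelOpen Ω) {τ : SpaceTime n → ℝ} {w : Fin n → Fin n → SpaceTime n → ℝ}
    (hτ : ParabolicDiff Ω 1 τ) (hw : ∀ i j, ParabolicDiff Ω 1 (w i j)) {c : ℝ}
    (h : ∀ p ∈ Ω, τ p * ((∑ i, w i i p) ^ 2 - ∑ i, ∑ j, w i j p ^ 2) = c) (k : Fin n) :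
    ∀ p ∈ Ω, dx k τ p * ((∑ i, w i i p) ^ 2 - ∑ i, ∑ j, w i j p ^ 2)
      + τ p * (2 * ((∑ i, w i i p) * ∑ i, dx k (w i i) p)
        - ∑ i, ∑ j, 2 * (w i j p * dx k (w i j) p)) = 0 := by
  rintro ⟨x, t⟩ hp
  have hd := (hτ.hasDerivAt_dx k hp).mul
    (((HasDerivAt.fun_sum (u := Finset.univ) fun i _ => (hw i i).hasDerivAt_dx k hp).pow 2).sub
      (HasDerivAt.fun_sum (u := Finset.univ) fun i _ => HasDerivAt.fun_sum (u := Finset.univ)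
        fun j _ => ((hw i j).hasDerivAt_dx k hp).pow 2))
  have := deriv_eq_zero_of_const hΩ h hp hd
  simpa [mul_assoc] using this

/-- The second derivative of an equation `τ ((tr w)² - |w|²) = c` in a direction `xₖ`. -/
lemma equation_dx_dx (hΩ : IsRelOpen Ω) {τ : SpaceTime n → ℝ}
    {w : Fin n → Fin n → SpaceTime n → ℝ}
    (hτ : ParabolicDiff Ω 2 τ) (hw : ∀ i j, ParabolicDiff Ω 2 (w i j)) {c : ℝ}
    (h : ∀ p ∈ Ω, τ p * ((∑ i, w i i p) ^ 2 - ∑ i, ∑ j, w i j p ^ 2) = c) (k : Fin n) :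
    ∀ p ∈ Ω, dx k (dx k τ) p * ((∑ i, w i i p) ^ 2 - ∑ i, ∑ j, w i j p ^ 2)
      + 2 * dx k τ p * (2 * ((∑ i, w i i p) * ∑ i, dx k (w i i) p)
        - ∑ i, ∑ j, 2 * (w i j p * dx k (w i j) p))
      + τ p * (2 * ((∑ i, dx k (w i i) p) ^ 2 + (∑ i, w i i p) * ∑ i, dx k (dx k (w i i)) p)
        - ∑ i, ∑ j, 2 * (dx k (w i j) p ^ 2 + w i j p * dx k (dx k (w i j)) p)) = 0 := by
  have h' := equation_dx hΩ hτ.of_succ (fun i j => (hw i j).of_succ) h k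
  rintro ⟨x, t⟩ hp
  have hs1 := HasDerivAt.fun_sum (u := Finset.univ) fun i _ => (hw i i).hasDerivAt_dx k hp
  have hs2 := HasDerivAt.fun_sum (u := Finset.univ) fun i _ => ((hw i i).dx k).hasDerivAt_dx k hp
  have hd := (((hτ.dx k).hasDerivAt_dx k hp).mul
    ((hs1.pow 2).sub
      (HasDerivAt.fun_sum (u := Finset.univ) fun i _ => HasDerivAt.fun_sum (u := Finset.univ)
        fun j _ => ((hw i j).hasDerivAt_dx k hp).pow 2))).add
    ((hτ.hasDerivAt_dx k hp).mul (((hs1.mul hs2).const_mul 2).sub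
      (HasDerivAt.fun_sum (u := Finset.univ) fun i _ => HasDerivAt.fun_sum (u := Finset.univ)
        fun j _ => (((hw i j).hasDerivAt_dx k hp).mul
          (((hw i j).dx k).hasDerivAt_dx k hp)).const_mul 2)))
  have := deriv_eq_zero_of_const hΩ h' hp hd
  simp only [Pi.sub_apply, Pi.mul_apply, Pi.pow_apply, zero_smul, add_zero, Nat.cast_ofNat,
    Nat.add_one_sub_one, pow_one] at this
  rw [← this]
  simp only [sq, mul_assoc]
  ring

/-- The equation differentiated twice and traced: the linearized operator applied to `Δu`. -/
lemma linearized_lap (hΩ : IsRelOpen Ω) (hu : IsC42 Ω u)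
    (heq : ∀ p ∈ Ω, -dt u p * sigma 2 (hess u p) = 1) {p : SpaceTime n} (hp : p ∈ Ω)
    (ht : p.2 < 0) :
    lap u p * ∑ i, ∑ k, dx i (dx i (dx k (dx k u))) p
      - ∑ i, ∑ j, hess u p i j * ∑ k, dx j (dx i (dx k (dx k u))) p
      = sigma 2 (hess u p) ^ 2 * ∑ k, dt (dx k (dx k u)) p
        + 2 / sigma 2 (hess u p) * ∑ k, (lap u p * ∑ i, dx k (dx i (dx i u)) p
          - ∑ i, ∑ j, hess u p i j * dx k (dx i (dx j u)) p) ^ 2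
        + ∑ i, ∑ j, ∑ k, dx k (dx i (dx j u)) p ^ 2
        - ∑ k, (∑ i, dx k (dx i (dx i u)) p) ^ 2 := by
  -- Writing `2σ₂` as `(tr)² - |·|²` makes the equation polynomial in the second derivatives, so no
  -- eigenvalue is ever differentiated.
  have h2 : ∀ p ∈ Ω, dt u p * ((∑ i, dx i (dx i u) p) ^ 2 - ∑ i, ∑ j, dx i (dx j u) p ^ 2)
      = -2 := by
    intro p hp
    have h3 : (∑ i, dx i (dx i u) p) ^ 2 - ∑ i, ∑ j, dx i (dx j u) p ^ 2
        = 2 * sigma 2 (hess u p) := (two_mul_sigma_two (hess_symm hΩ hu hp)).symm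
    rw [h3]
    linarith [heq p hp]
  have e0 := heq p hp
  have e2 : (∑ i, dx i (dx i u) p) ^ 2 - ∑ i, ∑ j, dx i (dx j u) p ^ 2
        = 2 * sigma 2 (hess u p) := (two_mul_sigma_two (hess_symm hΩ hu hp)).symm
  set q := sigma 2 (hess u p) with hq
  have hq0 : q ≠ 0 := by rintro h; rw [h] at e0; simp at e0
  have hτ : dt u p = -(1 / q) := by field_simp; linarith
  have hE1 := fun k => equation_dx hΩ hu.2.dt.of_succ (w := fun i j => dx i (dx j u))
    (fun i j => ((hu.2.dx j).dx i).of_succ) h2 k p hp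
  have hE2 := fun k => equation_dx_dx hΩ hu.2.dt (w := fun i j => dx i (dx j u))
    (fun i j => (hu.2.dx j).dx i) h2 k p hp
  set f : Fin n → ℝ := fun k => lap u p * ∑ i, dx k (dx i (dx i u)) p
          - ∑ i, ∑ j, hess u p i j * dx k (dx i (dx j u)) p with hf
  have hfk : ∀ k, 2 * ((∑ i, dx i (dx i u) p) * ∑ i, dx k (dx i (dx i u)) p)
        - ∑ i, ∑ j, 2 * (dx i (dx j u) p * dx k (dx i (dx j u)) p) = 2 * f k := by
    intro k
    simp only [hf, lap, hess, Matrix.of_apply, ← Finset.mul_sum]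
    ring
  simp only [hfk, e2, hτ] at hE1 hE2
  have hτk : ∀ k, dx k (dt u) p = f k / q ^ 2 := by
    intro k
    have := hE1 k
    field_simp at this ⊢
    linarith
  have hk : ∀ k, lap u p * ∑ i, dx k (dx k (dx i (dx i u))) p
      - ∑ i, ∑ j, hess u p i j * dx k (dx k (dx i (dx j u))) p
      = q ^ 2 * dt (dx k (dx k u)) p + 2 / q * f k ^ 2
        + ∑ i, ∑ j, dx k (dx i (dx j u)) p ^ 2 - (∑ i, dx k (dx i (dx i u)) p) ^ 2 := by
    intro k
    have h4 := hE2 k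
    rw [hτk, dt_dx_dx_eq hΩ hu.2 k hp ht] at h4
    simp only [← Finset.mul_sum, Finset.sum_add_distrib] at h4
    simp only [hess, Matrix.of_apply, lap]
    field_simp at h4 ⊢
    linear_combination h4 / (-2)
  have hsum := Finset.sum_congr (rfl : (Finset.univ : Finset (Fin n)) = _) fun k _ => hk k
  simp only [Finset.sum_add_distrib, Finset.sum_sub_distrib, ← Finset.mul_sum] at hsum
  have c1 : ∑ i, ∑ j, ∑ k, dx k (dx i (dx j u)) p ^ 2
      = ∑ k, ∑ i, ∑ j, dx k (dx i (dx j u)) p ^ 2 := by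
    rw [Finset.sum_comm, Finset.sum_congr rfl fun j _ => Finset.sum_comm, Finset.sum_comm]
    exact Finset.sum_congr rfl fun k _ => Finset.sum_comm
  have c3 : ∑ i, ∑ j, hess u p i j * ∑ k, dx j (dx i (dx k (dx k u))) p
      = ∑ k, ∑ i, ∑ j, hess u p i j * dx k (dx k (dx i (dx j u))) p := by
    rw [Finset.sum_comm (f := fun k i => ∑ j, hess u p i j * dx k (dx k (dx i (dx j u))) p)]
    refine Finset.sum_congr rfl fun i _ => ?_
    rw [Finset.sum_comm (f := fun k j => hess u p i j * dx k (dx k (dx i (dx j u))) p)]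
    refine Finset.sum_congr rfl fun j _ => ?_
    rw [Finset.mul_sum]
    exact Finset.sum_congr rfl fun k _ => by rw [fourth_deriv_swap hΩ hu.2 i j k hp]
  rw [c1, c3]
  exact hsum

/-! ### The conditions at an interior maximum. -/

/-- The bound at an interior spatial maximum point of the test function. -/
lemma interior_max_bound (hΩ : IsRelOpen Ω) (hu : IsC42 Ω u) {A m₁ m₂ α : ℝ} (hA : 0 ≤ A)
    (hm₂ : 0 < m₂) (heq : ∀ p ∈ Ω, -dt u p * sigma 2 (hess u p) = 1)
    (h3 : ∀ p ∈ Ω, -A ≤ sigma 3 (hess u p)) (hdt : ∀ p ∈ Ω, -m₁ ≤ dt u p ∧ dt u p ≤ -m₂)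
    (hlap : ∀ p ∈ Ω, 0 < lap u p)
    {x y z : EuclideanSpace ℝ (Fin n)} {t : ℝ} (hp : (x, t) ∈ Ω) (ht : t < 0)
    (hneg : u (x, t) < 0) (hα : 8 ≤ α) (hyz : 2 * ‖(3 : ℝ) • (x - y) - (x - z)‖ ^ 2 ≤ α)
    (hK : jacobiThreshold A (1 / m₁) (1 / m₂) ≤ lap u (x, t))
    (hmax : IsLocalMax (fun w => α * Real.log (-u (w, t)) + Real.log (lap u (w, t))
      + 3 / 2 * ‖w - y‖ ^ 2 - 1 / 2 * ‖w - z‖ ^ 2) x)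
    (htime : -1 ≤ α * (dt u (x, t) / u (x, t)) + (∑ k, dt (dx k (dx k u)) (x, t)) / lap u (x, t)) :
    -u (x, t) * lap u (x, t) ≤ 3 * α * (1 / m₂) + -u (x, t) * (1 / m₂) ^ 2 := by
  have hdtp := hdt _ hp
  have e0 := heq _ hp
  set q := sigma 2 (hess u (x, t)) with hq
  have hm₁ : 0 < m₁ := by linarith
  have hq0 : 0 < q := by
    by_contra! h
    nlinarith
  have hτ : dt u (x, t) = -(1 / q) := by field_simp; linarith
  have hq1 : q ≤ 1 / m₂ := by
    rw [le_div_iff₀ hm₂]; nlinarith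
  have hq2 : 1 / m₁ ≤ q := by
    rw [div_le_iff₀ hm₁]; nlinarith
  -- First- and second-order conditions along the line through `x` in direction `ξ`; the two
  -- quadratic weights contribute `3 - 1 = 2` to the second derivative.
  have line : ∀ ξ : EuclideanSpace ℝ (Fin n),
      (α * ((∑ i, ξ i * dx i u (x, t)) / u (x, t))
        + (∑ j, ∑ k, ξ k * dx k (dx j (dx j u)) (x, t)) / lap u (x, t)
        + (3 * inner ℝ (x - y) ξ - inner ℝ (x - z) ξ) = 0) ∧
      (α * ((∑ i, ∑ j, ξ i * ξ j * dx j (dx i u) (x, t)) / u (x, t)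
          - ((∑ i, ξ i * dx i u (x, t)) / u (x, t)) ^ 2)
        + (∑ k, ∑ i, ∑ j, ξ i * ξ j * dx j (dx i (dx k (dx k u))) (x, t)) / lap u (x, t)
        - ((∑ j, ∑ k, ξ k * dx k (dx j (dx j u)) (x, t)) / lap u (x, t)) ^ 2
        + 2 * ‖ξ‖ ^ 2 ≤ 0) := by
    intro ξ
    have hmem := eventually_line_mem hΩ hp ξ
    have hx0 : x + (0 : ℝ) • ξ = x := by simp
    have hcont : Tendsto (fun s : ℝ => x + s • ξ) (𝓝 0) (𝓝 x) := by
      have : Continuous fun s : ℝ => x + s • ξ := by fun_prop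
      simpa using this.tendsto 0
    have hu0 : ∀ {s : ℝ}, (x + s • ξ, t) ∈ Ω → HasDerivAt (fun r : ℝ => u (x + r • ξ, t))
        (∑ i, ξ i * dx i u (x + s • ξ, t)) s := fun h =>
      hu.2.of_succ.of_succ.of_succ.hasDerivAt_line hΩ x ξ h
    have hS0 : ∀ {s : ℝ}, (x + s • ξ, t) ∈ Ω → HasDerivAt (fun r : ℝ => lap u (x + r • ξ, t))
        (∑ j, ∑ k, ξ k * dx k (dx j (dx j u)) (x + s • ξ, t)) s := fun h =>
      HasDerivAt.fun_sum fun j _ => ((hu.2.dx j).dx j).of_succ.hasDerivAt_line hΩ x ξ h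
    have hline : ∀ s : ℝ, HasDerivAt (fun r : ℝ => x + r • ξ) ξ s := fun s => by
      simpa using ((hasDerivAt_id s).smul_const ξ).const_add x
    have hnegev : ∀ᶠ s : ℝ in 𝓝 0, u (x + s • ξ, t) < 0 := by
      have h1 := (hu0 (s := 0) (by rwa [hx0])).continuousAt
      have h2 : Tendsto (fun r : ℝ => u (x + r • ξ, t)) (𝓝 0) (𝓝 (u (x, t))) := by
        simpa [ContinuousAt] using h1
      exact h2.eventually_lt_const hneg
    have hquad : ∀ (c : EuclideanSpace ℝ (Fin n)) (s : ℝ),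
        HasDerivAt (fun r : ℝ => ‖x + r • ξ - c‖ ^ 2) (2 * inner ℝ (x + s • ξ - c) ξ) s :=
      fun c s => ((hline s).sub_const c).norm_sq
    have hquad' : ∀ (c : EuclideanSpace ℝ (Fin n)),
        HasDerivAt (fun r : ℝ => inner ℝ (x + r • ξ - c) ξ) (‖ξ‖ ^ 2) 0 := fun c => by
      have := ((hline 0).sub_const c).inner ℝ (hasDerivAt_const (0 : ℝ) ξ)
      simpa using this
    have hloc : IsLocalMax (fun s : ℝ => α * Real.log (-u (x + s • ξ, t))
        + Real.log (lap u (x + s • ξ, t)) + 3 / 2 * ‖x + s • ξ - y‖ ^ 2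
        - 1 / 2 * ‖x + s • ξ - z‖ ^ 2) 0 := by
      have := hcont.eventually hmax
      simpa [IsLocalMax, IsMaxFilter] using this
    have hmem0 : (x + (0 : ℝ) • ξ, t) ∈ Ω := by rwa [hx0]
    have hd2 := ((((hu.2.of_succ.of_succ.hasDerivAt_line₂ hΩ x ξ hmem0).div
      (hu0 hmem0) (by rw [hx0]; exact hneg.ne)).const_mul α).add
      ((HasDerivAt.fun_sum (u := Finset.univ) fun j _ =>
        ((hu.2.dx j).dx j).hasDerivAt_line₂ hΩ x ξ hmem0).div
      (hS0 hmem0) (by rw [hx0]; exact (hlap _ hp).ne'))).add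
      (((hquad' y).const_mul 3).sub (hquad' z))
    have key := deriv_conditions_of_isLocalMax (g' := fun s : ℝ =>
        α * ((∑ i, ξ i * dx i u (x + s • ξ, t)) / u (x + s • ξ, t))
        + (∑ j, ∑ k, ξ k * dx k (dx j (dx j u)) (x + s • ξ, t)) / lap u (x + s • ξ, t)
        + (3 * inner ℝ (x + s • ξ - y) ξ - inner ℝ (x + s • ξ - z) ξ)) hloc
      (by
        filter_upwards [hmem, hnegev] with s hs hs'
        have h1 := ((hu0 hs).neg.log (by simpa using hs'.ne)).const_mul α
        have h2 := (hS0 hs).log (hlap _ hs).ne'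
        refine (((h1.add h2).add ((hquad y s).const_mul (3 / 2))).sub
          ((hquad z s).const_mul (1 / 2))).congr_deriv ?_
        rw [Pi.neg_apply, neg_div_neg_eq]
        ring)
      hd2
    rw [hx0] at key
    refine ⟨key.1, ?_⟩
    have hune := hneg.ne
    have hlne := (hlap _ hp).ne'
    refine le_trans (le_of_eq ?_) key.2
    field_simp
    ring
  have hlin := linearized_lap hΩ hu heq hp ht
  refine max_point_bound (W := hess u (x, t))
    (V := fun i j => ∑ k, dx j (dx i (dx k (dx k u))) (x, t))
    (T := fun i j k => dx k (dx i (dx j u)) (x, t)) (g := fun i => dx i u (x, t))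
    (y := fun i => ((3 : ℝ) • (x - y) - (x - z)) i) (θ := ∑ k, dt (dx k (dx k u)) (x, t))
    (hess_symm hΩ hu hp) hA (by positivity) hq hq2 hq1 rfl (h3 _ hp) hK
    (fun i j k => third_deriv_swap₁ hΩ hu.2.of_succ.of_succ i j k hp)
    (fun i j k => third_deriv_swap₂ hΩ hu.2.of_succ i j k hp) hneg hα ?_ hlin
    (fun ξ => ?_) (fun ξ => ?_) ?_
  · rw [EuclideanSpace.norm_sq_eq] at hyz
    simpa using hyz
  · have := (line (WithLp.toLp 2 ξ)).1
    rw [← this]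
    have e1 : ∑ k, ξ k * ∑ i, dx k (dx i (dx i u)) (x, t)
        = ∑ j, ∑ k, ξ k * dx k (dx j (dx j u)) (x, t) := by
      simp_rw [Finset.mul_sum]
      rw [Finset.sum_comm]
    rw [e1]
    congr 1
    have e2 : ∀ v : EuclideanSpace ℝ (Fin n), inner ℝ v (WithLp.toLp 2 ξ) = ∑ i, ξ i * v i := by
      intro v
      simp [PiLp.inner_apply]
    rw [e2, e2, Finset.mul_sum, ← Finset.sum_sub_distrib]
    exact Finset.sum_congr rfl fun i _ => by simp; ring
  · have := (line (WithLp.toLp 2 ξ)).2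
    refine le_trans (le_of_eq ?_) this
    have e1 : ∑ k, ξ k * ∑ i, dx k (dx i (dx i u)) (x, t)
        = ∑ j, ∑ k, ξ k * dx k (dx j (dx j u)) (x, t) := by
      simp_rw [Finset.mul_sum]
      rw [Finset.sum_comm]
    have e2 : ∑ i, ∑ j, ξ i * ξ j * ∑ k, dx j (dx i (dx k (dx k u))) (x, t)
        = ∑ k, ∑ i, ∑ j, ξ i * ξ j * dx j (dx i (dx k (dx k u))) (x, t) := by
      simp_rw [Finset.mul_sum]
      rw [Finset.sum_congr rfl fun i _ => Finset.sum_comm, Finset.sum_comm]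
    have e3 : ∑ i, ∑ j, ξ i * ξ j * hess u (x, t) i j
        = ∑ i, ∑ j, ξ i * ξ j * dx j (dx i u) (x, t) :=
      Finset.sum_congr rfl fun i _ => Finset.sum_congr rfl fun j _ => by
        rw [hess_symm hΩ hu hp i j]; rfl
    rw [e1, e2, e3, EuclideanSpace.norm_sq_eq]
    simp
  · rw [← hτ]; exact htime

/-! ### Backward cylinders and the sign of the solution. -/

lemma IsRelOpen.time_nonpos (hΩ : IsRelOpen Ω) {p : SpaceTime n} (hp : p ∈ closure Ω) :
    p.2 ≤ 0 := by
  obtain ⟨V, -, rfl⟩ := hΩ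
  exact closure_minimal inter_subset_right (isClosed_le continuous_snd continuous_const) hp

lemma IsRelOpen.exists_backward_cylinder (hΩ : IsRelOpen Ω) {p : SpaceTime n} (hp : p ∈ Ω) :
    ∃ r : ℝ, 0 < r ∧ Metric.ball p.1 r ×ˢ Ioo (p.2 - r ^ 2) p.2 ⊆ Ω := by
  obtain ⟨V, hV, rfl⟩ := hΩ
  obtain ⟨ε, hε, h⟩ := Metric.isOpen_iff.1 hV p hp.1
  have hr : 0 < min 1 ε := by positivity
  refine ⟨min 1 ε, hr, fun q hq => ⟨h ?_, hq.2.2.le.trans hp.2⟩⟩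
  have h1 : min 1 ε ^ 2 ≤ ε := by
    have := min_le_left 1 ε
    have := min_le_right 1 ε
    nlinarith
  rw [Metric.mem_ball, Prod.dist_eq, max_lt_iff]
  refine ⟨lt_of_lt_of_le hq.1 (min_le_right _ _), ?_⟩
  rw [Real.dist_eq, abs_lt]
  exact ⟨by linarith [hq.2.1], by linarith [hq.2.2]⟩

lemma exists_backward_cylinder_of_notMem {p : SpaceTime n} (hp : p ∈ closure Ω)
    (hp' : p ∉ parabolicBoundary Ω) :
    ∃ r : ℝ, 0 < r ∧ Metric.ball p.1 r ×ˢ Ioo (p.2 - r ^ 2) p.2 ⊆ Ω := by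
  by_contra! h
  exact hp' ⟨hp, h⟩

/-- Below a point with a backward cylinder in `Ω` the function is larger. -/
lemma lt_of_backward_cylinder (hΩ : IsRelOpen Ω) (hc : ContinuousOn u (closure Ω))
    (ht : HasDt Ω u) (hdt : ∀ p ∈ Ω, dt u p < 0) {x : EuclideanSpace ℝ (Fin n)} {t r s : ℝ}
    (hp : (x, t) ∈ closure Ω) (hr : 0 < r) (h : Metric.ball x r ×ˢ Ioo (t - r ^ 2) t ⊆ Ω)
    (hs : s ∈ Ioo (t - r ^ 2) t) : u (x, t) < u (x, s) := by
  have hmem : ∀ σ ∈ Ico s t, (x, σ) ∈ Ω := fun σ hσ =>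
    h ⟨Metric.mem_ball_self hr, hs.1.trans_le hσ.1, hσ.2⟩
  have hcl : ∀ σ ∈ Icc s t, (x, σ) ∈ closure Ω := fun σ hσ => by
    rcases hσ.2.lt_or_eq with h' | rfl
    · exact subset_closure (hmem σ ⟨hσ.1, h'⟩)
    · exact hp
  have hanti : StrictAntiOn (fun σ => u (x, σ)) (Icc s t) := by
    refine strictAntiOn_of_deriv_neg (convex_Icc _ _) ?_ fun σ hσ => ?_
    · exact hc.comp (by fun_prop) hcl
    · rw [interior_Icc] at hσ
      have hm := hmem σ ⟨hσ.1.le, hσ.2⟩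
      have := ht.hasDerivAt hm (lt_of_lt_of_le hσ.2 (hΩ.time_nonpos hp))
      rw [this.deriv]
      exact hdt _ hm
  exact hanti ⟨le_rfl, hs.2.le⟩ ⟨hs.2.le, le_rfl⟩ hs.2

/-- A maximum point over the compact closure cannot have a backward cylinder in `Ω`, since `u` is
strictly larger just below it; so it lies on the parabolic boundary. -/
lemma nonpos_on_closure (hΩ : IsRelOpen Ω) (hb : Bornology.IsBounded Ω)
    (hc : ContinuousOn u (closure Ω)) (ht : HasDt Ω u) (hdt : ∀ p ∈ Ω, dt u p < 0)
    (h0 : ∀ p ∈ parabolicBoundary Ω, u p = 0) : ∀ p ∈ closure Ω, u p ≤ 0 := by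
  intro p hp
  obtain ⟨⟨x, t⟩, hm, hmax⟩ := hb.isCompact_closure.exists_isMaxOn ⟨p, hp⟩ hc
  refine (hmax hp).trans ?_
  by_cases hbd : (x, t) ∈ parabolicBoundary Ω
  · exact (h0 _ hbd).le
  · obtain ⟨r, hr, h⟩ := exists_backward_cylinder_of_notMem hm hbd
    have hs : t - r ^ 2 / 2 ∈ Ioo (t - r ^ 2) t := by
      have : 0 < r ^ 2 := by positivity
      constructor <;> linarith
    have h1 := lt_of_backward_cylinder hΩ hc ht hdt hm hr h hs
    have hin : (x, t - r ^ 2 / 2) ∈ Ω := h ⟨Metric.mem_ball_self hr, hs⟩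
    have h2 : u (x, t - r ^ 2 / 2) ≤ u (x, t) := hmax (subset_closure hin)
    exact absurd h1 (not_lt.2 h2)

lemma neg_on_domain (hΩ : IsRelOpen Ω) (hb : Bornology.IsBounded Ω)
    (hc : ContinuousOn u (closure Ω)) (ht : HasDt Ω u) (hdt : ∀ p ∈ Ω, dt u p < 0)
    (h0 : ∀ p ∈ parabolicBoundary Ω, u p = 0) : ∀ p ∈ Ω, u p < 0 := by
  rintro ⟨x, t⟩ hp
  obtain ⟨r, hr, h⟩ := hΩ.exists_backward_cylinder hp
  have hs : t - r ^ 2 / 2 ∈ Ioo (t - r ^ 2) t := by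
    have : 0 < r ^ 2 := by positivity
    constructor <;> linarith
  exact (lt_of_backward_cylinder hΩ hc ht hdt (subset_closure hp) hr h hs).trans_le
    (nonpos_on_closure hΩ hb hc ht hdt h0 _ (subset_closure (h ⟨Metric.mem_ball_self hr, hs⟩)))

lemma mem_closure_of_backward_cylinder {x z : EuclideanSpace ℝ (Fin n)} {t r : ℝ} (hr : 0 < r)
    (h : Metric.ball x r ×ˢ Ioo (t - r ^ 2) t ⊆ Ω) (hz : z ∈ Metric.ball x r) :
    (z, t) ∈ closure Ω := by
  refine closure_mono h ?_
  have : 0 < r ^ 2 := by positivity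
  rw [closure_prod_eq, closure_Ioo (by linarith)]
  exact ⟨subset_closure hz, by linarith, le_rfl⟩

/-- Near a point of the closure where `u < 0`, the slices of the closure contain balls. -/
lemma exists_ball_slice_closure (hc : ContinuousOn u (closure Ω))
    (h0 : ∀ p ∈ parabolicBoundary Ω, u p = 0) {y : EuclideanSpace ℝ (Fin n)} {r₀ : ℝ}
    (hp : (y, r₀) ∈ closure Ω) (hneg : u (y, r₀) < 0) :
    ∃ ρ : ℝ, 0 < ρ ∧ ∀ r, |r - r₀| < ρ → (y, r) ∈ closure Ω →
      ∀ z ∈ Metric.ball y ρ, (z, r) ∈ closure Ω ∧ u (z, r) < 0 := by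
  have hev : ∀ᶠ q in 𝓝[closure Ω] (y, r₀), u q < 0 := (hc _ hp).eventually_lt_const hneg
  obtain ⟨ρ, hρ, H⟩ := Metric.mem_nhdsWithin_iff.1 hev
  have H' : ∀ z r, z ∈ Metric.ball y ρ → |r - r₀| < ρ → (z, r) ∈ closure Ω → u (z, r) < 0 :=
    fun z r hz hr hzr => H ⟨by
      rw [Metric.mem_ball, Prod.dist_eq, max_lt_iff]
      exact ⟨hz, by simpa [Real.dist_eq] using hr⟩, hzr⟩
  refine ⟨ρ, hρ, fun r hr hyr => ?_⟩
  set F : Set (EuclideanSpace ℝ (Fin n)) := {z | z ∈ Metric.ball y ρ ∧ (z, r) ∈ closure Ω} with hF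
  -- Since `u < 0` keeps the points of `F` off the parabolic boundary, each has a backward cylinder,
  -- and the top disc of that cylinder lies in the closure. Connectedness of the ball does the rest.
  have hopen : IsOpen F := by
    rw [Metric.isOpen_iff]
    rintro z ⟨hz, hzr⟩
    have hbd : (z, r) ∉ parabolicBoundary Ω := fun hb => (H' z r hz hr hzr).ne (h0 _ hb)
    obtain ⟨a, ha, hcyl⟩ := exists_backward_cylinder_of_notMem hzr hbd
    obtain ⟨b, hb, hball⟩ := Metric.isOpen_iff.1 Metric.isOpen_ball z hz
    refine ⟨min a b, by positivity, fun w hw => ⟨hball ?_, ?_⟩⟩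
    · exact Metric.ball_subset_ball (min_le_right _ _) hw
    · exact mem_closure_of_backward_cylinder ha hcyl
        (Metric.ball_subset_ball (min_le_left _ _) hw)
  have hclosed : closure F ∩ Metric.ball y ρ ⊆ F := by
    rintro z ⟨hz, hzb⟩
    refine ⟨hzb, ?_⟩
    have hcl : IsClosed {z : EuclideanSpace ℝ (Fin n) | (z, r) ∈ closure Ω} :=
      isClosed_closure.preimage (by fun_prop : Continuous fun z => (z, r))
    exact closure_minimal (fun w hw => hw.2) hcl hz
  have hsub : Metric.ball y ρ ⊆ F :=
    (convex_ball y ρ).isPreconnected.subset_of_closure_inter_subset hopen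
      ⟨y, Metric.mem_ball_self hρ, Metric.mem_ball_self hρ, hyr⟩ hclosed
  exact fun z hz => ⟨(hsub hz).2, H' z r hz hr (hsub hz).2⟩

/-! ### The compact set on which the test function is maximized. -/

/-- The points of the closure of `Ω` from which the vertical segment up to the time `T` stays in
the closure, with `u` at most its initial value along it. -/
def verticalHull (Ω : Set (SpaceTime n)) (u : SpaceTime n → ℝ) (T : ℝ) : Set (SpaceTime n) :=
  {p | p.2 ≤ T ∧ ∀ r ∈ Icc p.2 T, (p.1, r) ∈ closure Ω ∧ u (p.1, r) ≤ u p}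

lemma verticalHull_subset {T : ℝ} : verticalHull Ω u T ⊆ closure Ω :=
  fun p hp => (hp.2 p.2 ⟨le_rfl, hp.1⟩).1

lemma isCompact_verticalHull (hb : Bornology.IsBounded Ω) (hc : ContinuousOn u (closure Ω))
    (T : ℝ) : IsCompact (verticalHull Ω u T) := by
  refine hb.isCompact_closure.of_isClosed_subset ?_ verticalHull_subset
  refine IsSeqClosed.isClosed fun p q hp hq => ?_
  have hq2 : Tendsto (fun k => (p k).2) atTop (𝓝 q.2) := (continuous_snd.tendsto q).comp hq
  have hq1 : Tendsto (fun k => (p k).1) atTop (𝓝 q.1) := (continuous_fst.tendsto q).comp hq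
  refine ⟨le_of_tendsto' hq2 fun k => (hp k).1, fun r hr => ?_⟩
  -- The time `r` may precede the start of the segment over `p k`, so it is clamped to that segment;
  -- the clamping disappears in the limit.
  have hlim : Tendsto (fun k => ((p k).1, max r (p k).2)) atTop (𝓝 (q.1, r)) := by
    refine hq1.prodMk_nhds ?_
    have := (tendsto_const_nhds (x := r)).max hq2
    rwa [max_eq_left hr.1] at this
  have hmem : ∀ k, ((p k).1, max r (p k).2) ∈ closure Ω ∧
      u ((p k).1, max r (p k).2) ≤ u (p k) := fun k =>
    (hp k).2 _ ⟨le_max_right _ _, max_le hr.2 (hp k).1⟩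
  have hcl : (q.1, r) ∈ closure Ω :=
    isClosed_closure.mem_of_tendsto hlim (Eventually.of_forall fun k => (hmem k).1)
  have hqcl : q ∈ closure Ω :=
    isClosed_closure.mem_of_tendsto hq (Eventually.of_forall fun k => verticalHull_subset (hp k))
  refine ⟨hcl, le_of_tendsto_of_tendsto' (b := atTop) ?_ ?_ fun k => (hmem k).2⟩
  · exact (hc _ hcl).tendsto.comp (tendsto_nhdsWithin_iff.2
      ⟨hlim, Eventually.of_forall fun k => (hmem k).1⟩)
  · exact (hc _ hqcl).tendsto.comp (tendsto_nhdsWithin_iff.2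
      ⟨hq, Eventually.of_forall fun k => verticalHull_subset (hp k)⟩)

/-- Along the segment above `p` the values stay at most `u p < 0`, so `exists_ball_slice_closure`
applies at each time, and compactness gives a uniform radius. -/
lemma verticalHull_exists_ball (hc : ContinuousOn u (closure Ω))
    (h0 : ∀ p ∈ parabolicBoundary Ω, u p = 0) {T : ℝ} {p : SpaceTime n}
    (hp : p ∈ verticalHull Ω u T) (hneg : u p < 0) :
    ∃ ρ : ℝ, 0 < ρ ∧ ∀ r ∈ Icc p.2 T, ∀ z ∈ Metric.ball p.1 ρ,
      (z, r) ∈ closure Ω ∧ u (z, r) < 0 := by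
  refine isCompact_Icc.induction_on (p := fun S => ∃ ρ : ℝ, 0 < ρ ∧ ∀ r ∈ S,
    ∀ z ∈ Metric.ball p.1 ρ, (z, r) ∈ closure Ω ∧ u (z, r) < 0) ?_ ?_ ?_ ?_
  · exact ⟨1, one_pos, by simp⟩
  · rintro S S' hS ⟨ρ, hρ, h⟩
    exact ⟨ρ, hρ, fun r hr => h r (hS hr)⟩
  · rintro S S' ⟨ρ, hρ, h⟩ ⟨ρ', hρ', h'⟩
    refine ⟨min ρ ρ', by positivity, fun r hr z hz => ?_⟩
    rcases hr with hr | hr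
    · exact h r hr z (Metric.ball_subset_ball (min_le_left _ _) hz)
    · exact h' r hr z (Metric.ball_subset_ball (min_le_right _ _) hz)
  · intro r₀ hr₀
    have h1 := hp.2 r₀ hr₀
    obtain ⟨ρ, hρ, H⟩ := exists_ball_slice_closure hc h0 h1.1 (h1.2.trans_lt hneg)
    refine ⟨Metric.ball r₀ ρ ∩ Icc p.2 T, ?_, ρ, hρ, fun r hr => ?_⟩
    · exact inter_mem (mem_nhdsWithin_of_mem_nhds (Metric.ball_mem_nhds r₀ hρ))
        self_mem_nhdsWithin
    · exact H r (by simpa [Real.dist_eq] using hr.1) (hp.2 r hr.2).1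

/-- A point of the vertical hull with `u < 0` has a backward cylinder in the hull. -/
lemma verticalHull_exists_cylinder (hΩ : IsRelOpen Ω) (hc : ContinuousOn u (closure Ω))
    (ht : HasDt Ω u) (hdt : ∀ p ∈ Ω, dt u p < 0) (hneg' : ∀ p ∈ Ω, u p < 0)
    (h0 : ∀ p ∈ parabolicBoundary Ω, u p = 0) {T : ℝ} {p : SpaceTime n}
    (hp : p ∈ verticalHull Ω u T) (hneg : u p < 0) :
    ∃ ρ : ℝ, 0 < ρ ∧ Metric.ball p.1 ρ ×ˢ Ioo (p.2 - ρ) p.2 ⊆ verticalHull Ω u T ∩ Ω := by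
  obtain ⟨ρ, hρ, H⟩ := verticalHull_exists_ball hc h0 hp hneg
  obtain ⟨r, hr, hcyl⟩ := exists_backward_cylinder_of_notMem (verticalHull_subset hp)
    (fun hb => hneg.ne (h0 _ hb))
  refine ⟨min ρ (min r (r ^ 2)), by positivity, ?_⟩
  rintro ⟨z, s⟩ ⟨hz, hs⟩
  have hz1 : z ∈ Metric.ball p.1 ρ := Metric.ball_subset_ball (min_le_left _ _) hz
  have hz2 : z ∈ Metric.ball p.1 r :=
    Metric.ball_subset_ball ((min_le_right _ _).trans (min_le_left _ _)) hz
  have hmin : min ρ (min r (r ^ 2)) ≤ r ^ 2 := (min_le_right _ _).trans (min_le_right _ _)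
  have hs1 : p.2 - r ^ 2 < s := by have := hs.1; simp only at this; linarith
  have hs2 : s < p.2 := hs.2
  have hin : ∀ σ ∈ Ico s p.2, (z, σ) ∈ Ω := fun σ hσ => hcyl ⟨hz2, hs1.trans_le hσ.1, hσ.2⟩
  have hall : ∀ σ ∈ Icc s T, (z, σ) ∈ closure Ω ∧ u (z, σ) < 0 := by
    intro σ hσ
    rcases lt_or_ge σ p.2 with h | h
    · exact ⟨subset_closure (hin σ ⟨hσ.1, h⟩), hneg' _ (hin σ ⟨hσ.1, h⟩)⟩
    · exact H σ ⟨h, hσ.2⟩ z hz1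
  have hsT : s ≤ T := hs2.le.trans hp.1
  have hcont : ContinuousOn (fun σ => u (z, σ)) (Icc s T) :=
    hc.comp (by fun_prop) fun σ hσ => (hall σ hσ).1
  obtain ⟨m, hm, hmax⟩ := isCompact_Icc.exists_isMaxOn ⟨s, le_rfl, hsT⟩ hcont
  -- At a later maximum point the backward cylinder would supply earlier, strictly larger values of
  -- `u` on the same segment.
  have hms : m = s := by
    by_contra hne
    have hlt : s < m := lt_of_le_of_ne hm.1 (Ne.symm hne)
    have hmm := hall m hm
    obtain ⟨a, ha, hcyl'⟩ := exists_backward_cylinder_of_notMem hmm.1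
      (fun hb => hmm.2.ne (h0 _ hb))
    obtain ⟨σ, hσ1, hσ2⟩ := exists_between (max_lt hlt (by
      have : 0 < a ^ 2 := by positivity
      linarith : m - a ^ 2 < m))
    have h1 := lt_of_backward_cylinder hΩ hc ht hdt hmm.1 ha hcyl'
      ⟨(le_max_right _ _).trans_lt hσ1, hσ2⟩
    have h2 := hmax (show σ ∈ Icc s T from
      ⟨((le_max_left _ _).trans_lt hσ1).le, hσ2.le.trans hm.2⟩)
    exact absurd h1 (not_lt.2 h2)
  refine ⟨⟨hsT, fun σ hσ => ⟨(hall σ hσ).1, ?_⟩⟩, hin s ⟨le_rfl, hs2⟩⟩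
  have := hmax hσ
  rw [hms] at this
  exact this

lemma dist_le_of_mem_verticalHull (hΩ : IsRelOpen Ω) (hb : Bornology.IsBounded Ω)
    (h0 : ∀ p ∈ parabolicBoundary Ω, u p = 0) {d : ℝ}
    (hd : ∀ t : ℝ, t ≤ 0 → Metric.diam (slice Ω t) ≤ d) {x : EuclideanSpace ℝ (Fin n)} {T : ℝ}
    (hx : (x, T) ∈ Ω) {p : SpaceTime n} (hp : p ∈ verticalHull Ω u T) (hneg : u p < 0) :
    dist p.1 x ≤ d := by
  have h1 := hp.2 T ⟨hp.1, le_rfl⟩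
  obtain ⟨a, ha, hcyl⟩ := exists_backward_cylinder_of_notMem h1.1
    (fun hb => (h1.2.trans_lt hneg).ne (h0 _ hb))
  obtain ⟨b, hb', hcyl'⟩ := hΩ.exists_backward_cylinder hx
  have ha2 : 0 < a ^ 2 := by positivity
  have hb2 : 0 < b ^ 2 := by positivity
  -- At time `T` the point above `p` is only known to lie in the closure; slightly earlier, both
  -- points lie in the same slice of `Ω`.
  obtain ⟨t, ht1, ht2⟩ := exists_between (max_lt (by linarith : T - a ^ 2 < T)
    (by linarith : T - b ^ 2 < T))
  have hT : T ≤ 0 := hΩ.time_nonpos (subset_closure hx)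
  refine le_trans (Metric.dist_le_diam_of_mem ?_ (?_ : p.1 ∈ slice Ω t) (?_ : x ∈ slice Ω t))
    (hd t (ht2.le.trans hT))
  · refine hb.image_fst.subset ?_
    exact fun y hy => ⟨(y, t), hy, rfl⟩
  · exact hcyl ⟨Metric.mem_ball_self ha, (le_max_left _ _).trans_lt ht1, ht2⟩
  · exact hcyl' ⟨Metric.mem_ball_self hb', (le_max_right _ _).trans_lt ht1, ht2⟩

/-! ### The perturbed maximum and the conclusion at it. -/

/-- A function that is at most its value at the centre of the top of a cylinder has, after a small
perturbation, a maximum in the interior of the cylinder. -/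
lemma exists_perturbed_max {φ : SpaceTime n → ℝ} {y : EuclideanSpace ℝ (Fin n)} {s₀ ρ φ₀ : ℝ}
    (hρ : 0 < ρ) (hcont : ContinuousOn φ (Metric.ball y ρ ×ˢ Ioo (s₀ - ρ) s₀))
    (hle : ∀ p ∈ Metric.ball y ρ ×ˢ Ioo (s₀ - ρ) s₀, φ p ≤ φ₀)
    (hlim : Tendsto (fun s => φ (y, s)) (𝓝[<] s₀) (𝓝 φ₀)) :
    ∃ x t, (x, t) ∈ Metric.ball y ρ ×ˢ Ioo (s₀ - ρ) s₀ ∧ ‖x - y‖ ≤ 1 ∧ φ₀ - 1 ≤ φ (x, t) ∧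
      IsLocalMax (fun w => φ (w, t) - 1 / 2 * ‖w - y‖ ^ 2) x ∧
      ∀ᶠ s in 𝓝[<] t, φ (x, s) + s ≤ φ (x, t) + t := by
  -- As `r ≤ 1/2`, both the penalty `r²/2` on the lateral boundary and the penalty `r ≥ 2r²` at the
  -- bottom exceed the loss `r²/4`. The top `t₁` may be attained, since only a one-sided maximum in
  -- time is claimed.
  set r := min ρ 1 / 2 with hr
  have hr0 : 0 < r := by positivity
  have hr1 : r ≤ 1 / 2 := by have := min_le_right ρ 1; linarith
  have hrρ : r < ρ := by have := min_le_left ρ 1; linarith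
  have hev : ∀ᶠ s in 𝓝[<] s₀, φ₀ - r ^ 2 / 8 < φ (y, s) ∧ s₀ - r ^ 2 / 8 < s ∧ s < s₀ := by
    have h1 := hlim.eventually_const_lt (by linarith [sq_pos_of_pos hr0] : φ₀ - r ^ 2 / 8 < φ₀)
    have h2 : ∀ᶠ s in 𝓝[<] s₀, s₀ - r ^ 2 / 8 < s :=
      mem_nhdsWithin_of_mem_nhds (Ioi_mem_nhds (by linarith [sq_pos_of_pos hr0]))
    filter_upwards [h1, h2, self_mem_nhdsWithin] with s a b c using ⟨a, b, c⟩
  obtain ⟨t₁, ht1, ht2, ht3⟩ := hev.exists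
  have hrr : r ^ 2 ≤ r / 2 := by nlinarith
  set C : Set (SpaceTime n) := Metric.closedBall y r ×ˢ Icc (s₀ - r) t₁ with hC
  have hCsub : C ⊆ Metric.ball y ρ ×ˢ Ioo (s₀ - ρ) s₀ := fun p hp =>
    ⟨Metric.closedBall_subset_ball hrρ hp.1, by linarith [hp.2.1], hp.2.2.trans_lt ht3⟩
  have hCc : IsCompact C := (isCompact_closedBall y r).prod isCompact_Icc
  have hmem : (y, t₁) ∈ C := ⟨Metric.mem_closedBall_self hr0.le, by linarith, le_rfl⟩
  obtain ⟨⟨x, t⟩, hxt, hmax⟩ := hCc.exists_isMaxOn ⟨_, hmem⟩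
    (f := fun p => φ p - 1 / 2 * ‖p.1 - y‖ ^ 2 + (p.2 - s₀))
    (((hcont.mono hCsub).sub (by fun_prop)).add (by fun_prop))
  have hval := hmax hmem
  simp only [mem_ofPred_eq, sub_self, norm_zero] at hval
  have hφle := hle _ (hCsub hxt)
  have htlt : t < s₀ := hxt.2.2.trans_lt ht3
  have hnn : 0 ≤ ‖x - y‖ ^ 2 := by positivity
  have hval' : φ₀ - r ^ 2 / 4 < φ (x, t) - 1 / 2 * ‖x - y‖ ^ 2 + (t - s₀) := by
    refine lt_of_lt_of_le ?_ hval
    norm_num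
    linarith
  have hxr : ‖x - y‖ < r := by
    by_contra! h
    have : r ^ 2 ≤ ‖x - y‖ ^ 2 := by gcongr
    nlinarith
  have htr : s₀ - r < t := by
    by_contra! h
    nlinarith
  refine ⟨x, t, hCsub hxt, by linarith, by nlinarith, ?_, ?_⟩
  · have hball : Metric.ball y r ∈ 𝓝 x := Metric.isOpen_ball.mem_nhds (by
      rw [Metric.mem_ball, dist_eq_norm]; exact hxr)
    filter_upwards [hball] with w hw
    have := hmax (show (w, t) ∈ C from ⟨Metric.ball_subset_closedBall hw, hxt.2⟩)
    simp only [mem_ofPred_eq] at this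
    linarith
  · have : Ioi (s₀ - r) ∈ 𝓝[<] t := mem_nhdsWithin_of_mem_nhds (Ioi_mem_nhds htr)
    filter_upwards [this, self_mem_nhdsWithin] with s hs hst
    have hs' : s < t := hst
    have := hmax (show (x, s) ∈ C from ⟨hxt.1, (mem_Ioi.1 hs).le, hs'.le.trans hxt.2.2⟩)
    simp only [mem_ofPred_eq] at this
    linarith

lemma nonneg_of_hasDerivAt_of_le_left {g : ℝ → ℝ} {g' t : ℝ} (hg : HasDerivAt g g' t)
    (h : ∀ᶠ s in 𝓝[<] t, g s ≤ g t) : 0 ≤ g' := by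
  have h1 := (hasDerivWithinAt_iff_tendsto_slope' (s := Iio t) (by simp)).1 hg.hasDerivWithinAt
  refine ge_of_tendsto h1 ?_
  filter_upwards [h, self_mem_nhdsWithin] with s hs hst
  have hst' : s < t := hst
  rw [slope_def_field]
  exact div_nonneg_of_nonpos (by linarith) (by linarith)

lemma matNorm_le_lap (hΩ : IsRelOpen Ω) (hu : IsC42 Ω u) {p : SpaceTime n} (hp : p ∈ Ω)
    (h2 : 0 < sigma 2 (hess u p)) (h1 : 0 < lap u p) : matNorm (hess u p) ≤ lap u p := by
  refine Real.sqrt_le_iff.2 ⟨h1.le, ?_⟩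
  have := two_mul_sigma_two (hess_symm hΩ hu hp)
  have e : lap u p = ∑ i, hess u p i i := rfl
  rw [e]
  linarith

lemma time_deriv_bound (hu : IsC42 Ω u) {x : EuclideanSpace ℝ (Fin n)} {t α c : ℝ}
    (hlap : 0 < lap u (x, t)) (hp : (x, t) ∈ Ω) (ht : t < 0) (hneg : u (x, t) < 0)
    (hleft : ∀ᶠ s in 𝓝[<] t, α * Real.log (-u (x, s)) + Real.log (lap u (x, s)) + c + s
      ≤ α * Real.log (-u (x, t)) + Real.log (lap u (x, t)) + c + t) :
    -1 ≤ α * (dt u (x, t) / u (x, t)) + (∑ k, dt (dx k (dx k u)) (x, t)) / lap u (x, t) := by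
  have h1 : HasDerivAt (fun r => u (x, r)) (dt u (x, t)) t := hu.2.hasDt.hasDerivAt hp ht
  have hk : ∀ k, HasDerivAt (fun r => dx k (dx k u) (x, r)) (dt (dx k (dx k u)) (x, t)) t :=
    fun k => HasDt.hasDerivAt (w := dx k (dx k u)) (p := (x, t)) ((hu.2.dx k).dx k).hasDt hp ht
  have h2 : HasDerivAt (fun r => lap u (x, r)) (∑ k, dt (dx k (dx k u)) (x, t)) t :=
    HasDerivAt.fun_sum fun k _ => hk k
  have h3 := ((((h1.fun_neg.log (by simpa using hneg.ne)).const_mul α).fun_add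
    (h2.log hlap.ne')).add_const c).fun_add (hasDerivAt_id' t)
  have h4 := nonneg_of_hasDerivAt_of_le_left h3 hleft
  rw [neg_div_neg_eq] at h4
  linarith

/-- The test function attains its maximum, up to a factor, at a point where the bound holds. -/
lemma exists_max_point (hΩ : IsRelOpen Ω) (hb : Bornology.IsBounded Ω) (hu : IsC42 Ω u)
    {A m₁ m₂ d α : ℝ} (hA : 0 ≤ A) (hm₂ : 0 < m₂)
    (heq : ∀ p ∈ Ω, -dt u p * sigma 2 (hess u p) = 1)
    (h0 : ∀ p ∈ parabolicBoundary Ω, u p = 0)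
    (h3 : ∀ p ∈ Ω, -A ≤ sigma 3 (hess u p)) (hdt : ∀ p ∈ Ω, -m₁ ≤ dt u p ∧ dt u p ≤ -m₂)
    (hd : ∀ t : ℝ, t ≤ 0 → Metric.diam (slice Ω t) ≤ d) (hlap : ∀ p ∈ Ω, 0 < lap u p)
    (hα : 2 * (3 * d + 1) ^ 2 + 8 ≤ α) {P : SpaceTime n} (hP : P ∈ Ω) :
    ∃ p ∈ Ω, u p < 0 ∧ dist p.1 P.1 ≤ d ∧
      (-u P) ^ α * lap u P ≤
        Real.exp 1 * ((-u p) ^ α * lap u p * Real.exp (3 / 2 * ‖p.1 - P.1‖ ^ 2)) ∧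
      (jacobiThreshold A (1 / m₁) (1 / m₂) ≤ lap u p →
        -u p * lap u p ≤ 3 * α * (1 / m₂) + -u p * (1 / m₂) ^ 2) := by
  obtain ⟨x₀, T⟩ := P
  have hdt' : ∀ p ∈ Ω, dt u p < 0 := fun p hp => by linarith [(hdt p hp).2]
  have hDt : HasDt Ω u := hu.2.hasDt
  have hneg := neg_on_domain hΩ hb hu.1 hDt hdt' h0
  have hnonpos := nonpos_on_closure hΩ hb hu.1 hDt hdt' h0
  have hd0 : 0 ≤ d := Metric.diam_nonneg.trans (hd 0 le_rfl)
  have hα8 : 8 ≤ α := by nlinarith [sq_nonneg (3 * d + 1)]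
  -- Outside `Ω` the second derivatives carry no information; their continuous extensions make `Φ`
  -- continuous on the closure.
  choose v hvc hve using fun i => ((hu.2.dx i).dx i).extendsCont
  set S : SpaceTime n → ℝ := fun p => ∑ i, v i p with hS
  have hSc : ContinuousOn S (closure Ω) := continuousOn_finsetSum _ fun i _ => hvc i
  have hSe : ∀ p ∈ Ω, S p = lap u p := fun p hp =>
    Finset.sum_congr rfl fun i _ => hve i hp
  set Φ : SpaceTime n → ℝ := fun p => (-u p) ^ α * S p * Real.exp (3 / 2 * ‖p.1 - x₀‖ ^ 2) with hΦ
  have hΦc : ContinuousOn Φ (closure Ω) := by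
    refine ((hu.1.neg.rpow_const fun p _ => Or.inr (by linarith)).mul hSc).mul ?_
    exact Continuous.continuousOn (by fun_prop)
  have hPK : (x₀, T) ∈ verticalHull Ω u T := by
    refine ⟨le_rfl, fun r hr => ?_⟩
    obtain rfl : r = T := le_antisymm hr.2 hr.1
    exact ⟨subset_closure hP, le_rfl⟩
  obtain ⟨⟨y, s⟩, hpK, hmax⟩ := (isCompact_verticalHull hb hu.1 T).exists_isMaxOn ⟨_, hPK⟩
    (hΦc.mono verticalHull_subset)
  have hΦP : Φ (x₀, T) = (-u (x₀, T)) ^ α * lap u (x₀, T) := by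
    simp [hΦ, hSe _ hP]
  have hΦpos : ∀ p ∈ Ω, 0 < Φ p := fun p hp => by
    have h1 : 0 < -u p := by linarith [hneg p hp]
    have h2 := hlap p hp
    simp only [hΦ, hSe p hp]
    positivity
  have hΦ0 : 0 < Φ (y, s) := (hΦpos _ hP).trans_le (hmax hPK)
  have hcl := verticalHull_subset hpK
  have hneg0 : u (y, s) < 0 := by
    refine lt_of_le_of_ne (hnonpos _ hcl) fun h => ?_
    simp [hΦ, h, Real.zero_rpow (by linarith : α ≠ 0)] at hΦ0
  obtain ⟨ρ, hρ, hcyl⟩ := verticalHull_exists_cylinder hΩ hu.1 hDt hdt' hneg h0 hpK hneg0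
  have hlog : ∀ p ∈ Ω, Real.log (Φ p) = α * Real.log (-u p) + Real.log (lap u p)
      + 3 / 2 * ‖p.1 - x₀‖ ^ 2 := fun p hp => by
    have h1 : 0 < -u p := by linarith [hneg p hp]
    have h2 := hlap p hp
    simp only [hΦ, hSe p hp]
    rw [Real.log_mul (by positivity) (by positivity), Real.log_mul (by positivity) h2.ne',
      Real.log_rpow h1, Real.log_exp]
  obtain ⟨x, t, hxt, hxy, hval, hloc, hleft⟩ := exists_perturbed_max (φ := fun p => Real.log (Φ p))
    (φ₀ := Real.log (Φ (y, s))) hρ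
    ((hΦc.mono fun p hp => subset_closure (hcyl hp).2).log fun p hp => (hΦpos p (hcyl hp).2).ne')
    (fun p hp => Real.log_le_log (hΦpos p (hcyl hp).2) (hmax (hcyl hp).1))
    (by
      refine Tendsto.log ?_ hΦ0.ne'
      refine (hΦc _ hcl).tendsto.comp (tendsto_nhdsWithin_iff.2 ⟨?_, ?_⟩)
      · exact (Continuous.tendsto (by fun_prop : Continuous fun r : ℝ => (y, r)) s).mono_left
          nhdsWithin_le_nhds
      · have : Ioi (s - ρ) ∈ 𝓝[<] s := mem_nhdsWithin_of_mem_nhds (Ioi_mem_nhds (by linarith))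
        filter_upwards [this, self_mem_nhdsWithin] with r hr hr'
        have hmem : (y, r) ∈ verticalHull Ω u T ∩ Ω := hcyl ⟨Metric.mem_ball_self hρ, hr, hr'⟩
        exact subset_closure hmem.2)
  have hin := (hcyl hxt).2
  have hst : t < s := hxt.2.2
  have ht : t < 0 := hst.trans_le (hΩ.time_nonpos hcl)
  have hdist := dist_le_of_mem_verticalHull hΩ hb h0 hd hP (hcyl hxt).1 (hneg _ hin)
  refine ⟨(x, t), hin, hneg _ hin, hdist, ?_, fun hK => ?_⟩
  · rw [← hΦP, ← hSe _ hin]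
    change Φ (x₀, T) ≤ Real.exp 1 * Φ (x, t)
    refine (hmax hPK : Φ (x₀, T) ≤ Φ (y, s)).trans ?_
    rw [← Real.log_le_log_iff hΦ0 (mul_pos (Real.exp_pos 1) (hΦpos _ hin)),
      Real.log_mul (Real.exp_pos 1).ne' (hΦpos _ hin).ne', Real.log_exp]
    linarith
  · refine interior_max_bound hΩ hu hA hm₂ heq h3 hdt hlap (y := x₀) (z := y) hin ht (hneg _ hin)
      hα8 ?_ hK ?_ ?_
    · have h1 : ‖(3 : ℝ) • (x - x₀) - (x - y)‖ ≤ 3 * d + 1 := by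
        refine (norm_sub_le _ _).trans ?_
        rw [norm_smul, ← dist_eq_norm x x₀]
        simp only [Real.norm_ofNat]
        linarith
      have h2 : ‖(3 : ℝ) • (x - x₀) - (x - y)‖ ^ 2 ≤ (3 * d + 1) ^ 2 := by gcongr
      linarith
    · refine hloc.congr ?_
      filter_upwards [hΩ.eventually_slice hin] with w hw
      rw [hlog _ hw]
    · have hev : ∀ᶠ r in 𝓝 t, (x, r) ∈ Ω :=
        (by fun_prop : Continuous fun r : ℝ => (x, r)).continuousAt (hΩ.mem_nhds hin ht)
      refine time_deriv_bound hu (hlap _ hin) hin ht (hneg _ hin)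
        (c := 3 / 2 * ‖x - x₀‖ ^ 2) ?_
      filter_upwards [hleft, nhdsWithin_le_nhds hev] with r hr hr'
      rwa [hlog _ hr', hlog _ hin] at hr

end

end ParabolicHessian

open ParabolicHessian in
theorem lemma2p3 (n : ℕ) (A m₁ m₂ d M : ℝ) (hA : 0 ≤ A) (hm₂ : 0 < m₂) (hm : m₂ ≤ m₁) :
    ∃ α₀ : ℝ, 0 < α₀ ∧ ∀ α : ℝ, α₀ ≤ α → ∃ C : ℝ,
      ∀ (Ω : Set (SpaceTime n)) (u : SpaceTime n → ℝ),
        IsRelOpen Ω → Bornology.IsBounded Ω →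
        IsC42 Ω u →
        IsConvexMonotone 2 Ω u →
        (∀ p ∈ Ω, -dt u p * sigma 2 (hess u p) = 1) →
        (∀ p ∈ parabolicBoundary Ω, u p = 0) →
        (∀ p ∈ Ω, -A ≤ sigma 3 (hess u p)) →
        (∀ p ∈ Ω, -m₁ ≤ dt u p ∧ dt u p ≤ -m₂) →
        (∀ t : ℝ, t ≤ 0 → Metric.diam (slice Ω t) ≤ d) →
        (∀ p ∈ Ω, |u p| ≤ M) →
        ∀ p ∈ Ω, u p ≤ 0 ∧ (-u p) ^ α * matNorm (hess u p) ≤ C := by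
  -- `3d + 1` bounds the gradient of the combined weight, and `8` is the size of `α` needed to
  -- absorb the quarter in the Jacobi inequality.
  refine ⟨2 * (3 * d + 1) ^ 2 + 8, by positivity, fun α hα => ?_⟩
  -- The two summands cover `Δu` below and above the threshold; `e` comes from the perturbation and
  -- the last exponential from the weight.
  refine ⟨Real.exp 1 * ((M ^ α * jacobiThreshold A (1 / m₁) (1 / m₂)
    + M ^ (α - 1) * (3 * α * (1 / m₂) + M * (1 / m₂) ^ 2)) * Real.exp (3 / 2 * d ^ 2)), ?_⟩
  intro Ω u hΩ hb hu hconv heq h0 h3 hdt hd hM P hP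
  have hlap : ∀ p ∈ Ω, 0 < lap u p := fun p hp => by
    have := hconv.1 p hp 1 le_rfl one_le_two
    rwa [sigma_one_eq (hess_symm hΩ hu hp)] at this
  have hσ2 : ∀ p ∈ Ω, 0 < sigma 2 (hess u p) := fun p hp => hconv.1 p hp 2 one_le_two le_rfl
  have hnegall := neg_on_domain hΩ hb hu.1 hu.2.hasDt
    (fun p hp => by linarith [(hdt p hp).2]) h0
  refine ⟨(hnegall P hP).le, ?_⟩
  have hα8 : 8 ≤ α := by nlinarith [sq_nonneg (3 * d + 1)]
  obtain ⟨p, hp, hneg, hdist, hbound, hbig⟩ := exists_max_point hΩ hb hu hA hm₂ heq h0 h3 hdt hd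
    hlap hα hP
  have hu0 : 0 < -u p := by linarith
  have huM : -u p ≤ M := (neg_le_abs _).trans (hM p hp)
  have hM0 : 0 < M := hu0.trans_le huM
  have hm₁ : 0 < m₁ := hm₂.trans_le hm
  have hK0 : 0 ≤ jacobiThreshold A (1 / m₁) (1 / m₂) := by
    unfold jacobiThreshold; positivity
  have hC2 : 0 ≤ 3 * α * (1 / m₂) + M * (1 / m₂) ^ 2 := by
    have : 0 ≤ α := by linarith
    positivity
  have hPn : 0 ≤ (-u P) ^ α := Real.rpow_nonneg (by linarith [hnegall P hP]) α
  have hlp := hlap p hp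
  calc (-u P) ^ α * matNorm (hess u P)
      ≤ (-u P) ^ α * lap u P :=
        mul_le_mul_of_nonneg_left (matNorm_le_lap hΩ hu hP (hσ2 P hP) (hlap P hP)) hPn
    _ ≤ _ := hbound
    _ ≤ _ := by
        have hexp : ‖p.1 - P.1‖ ^ 2 ≤ d ^ 2 := by
          rw [← dist_eq_norm]; gcongr
        have hmain : (-u p) ^ α * lap u p ≤ M ^ α * jacobiThreshold A (1 / m₁) (1 / m₂)
            + M ^ (α - 1) * (3 * α * (1 / m₂) + M * (1 / m₂) ^ 2) := by
          rcases le_total (lap u p) (jacobiThreshold A (1 / m₁) (1 / m₂)) with h | h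
          · have h1 : (-u p) ^ α * lap u p ≤ M ^ α * jacobiThreshold A (1 / m₁) (1 / m₂) := by
              gcongr
            have h2 : 0 ≤ M ^ (α - 1) * (3 * α * (1 / m₂) + M * (1 / m₂) ^ 2) := by positivity
            linarith
          · have e : (-u p) ^ α * lap u p = (-u p) ^ (α - 1) * (-u p * lap u p) := by
              rw [← mul_assoc, ← Real.rpow_add_one hu0.ne', sub_add_cancel]
            have h1 : -u p * lap u p ≤ 3 * α * (1 / m₂) + M * (1 / m₂) ^ 2 := by
              refine (hbig h).trans ?_
              gcongr
            have h2 : (-u p) ^ (α - 1) * (-u p * lap u p)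
                ≤ M ^ (α - 1) * (3 * α * (1 / m₂) + M * (1 / m₂) ^ 2) := by
              gcongr
              linarith
            have h3 : 0 ≤ M ^ α * jacobiThreshold A (1 / m₁) (1 / m₂) := by positivity
            rw [e]
            linarith
        gcongr
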